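/- For a set $U\subseteq\{0,1\}^n$ let $P_U=\operatorname{conv}(U)\subseteq\mathbb{R}^n$. A face of a polytope $P\subseteq\mathbb{R}^n$ is a set of the form $\{x\in P: c^\top x=\gamma\}$, where $c\in\mathbb{R}^n$ and $\gamma\in\mathbb{R}$ satisfy $c^\top x\le\gamma$ for all $x\in P$. The graph of $P$ has as vertices the $0$-dimensional faces of $P$ and as edges its $1$-dimensional faces. For a finite graph $G$ with vertex set $V(G)$ and $S,T\subseteq V(G)$, let $e(S,T)$ be the number of edges of $G$ with one endpoint in $S$ and the other in $T$, and let $$h(G)=\min\left\{\frac{e(S,V(G)\setminus S)}{|S|} : S\subseteq V(G),\ 1\le |S|\le \frac{|V(G)|}{2}\right\},$$ with $h(G)=0$ if $|V(G)|\le 1$. The random $0/1$-polytope $P_{n,p}$ is $P_U$ for the random set $U\subseteq\{0,1\}^n$ that contains each element of $\{0,1\}^n$ independently with probability $p$. **Theorem.** There are absolute constants $\beta,\eta>0$ such that the following holds. Let $(p(n))_{n\ge 0}$ be a sequence in $[0,1]$ with $p(n)\ge 2^{-0.99n}$ for all sufficiently large $n$. Then, with probability tending to $1$ as $n\to\infty$,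 the graph $G$ of $P_{n,p(n)}$ satisfies $h(G)\ge\beta$ and, moreover, every $A\subseteq V(G)$ with $|A|\le\eta|V(G)|$ satisfies $e(A,V(G)\setminus A)\ge|A|$. -/

import Mathlib

open Filter Topology

noncomputable section

namespace RandomPolytope

/-- `F` is a face of `P ⊆ ℝⁿ`: there are `c ∈ ℝⁿ` and `γ ∈ ℝ` with `cᵀx ≤ γ` for all `x ∈ P`
and `F = {x ∈ P : cᵀx = γ}`. -/
def IsFace {n : ℕ} (P F : Set (Fin n → ℝ)) : Prop :=
  ∃ (c : Fin n → ℝ) (γ : ℝ), (∀ x ∈ P, c ⬝ᵥ x ≤ γ) ∧ F = {x ∈ P | c ⬝ᵥ x = γ}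

/-- `F` is a `k`-face of `P`: a nonempty face whose affine span has dimension `k`. -/
def IsFaceOfDim {n : ℕ} (P F : Set (Fin n → ℝ)) (k : ℕ) : Prop :=
  IsFace P F ∧ F.Nonempty ∧ Module.finrank ℝ (affineSpan ℝ F).direction = k

/-- The vertices of `P`: the points `x` such that `{x}` is a `0`-face of `P`
(a nonempty set of dimension `0` is a single point). -/
def vertices {n : ℕ} (P : Set (Fin n → ℝ)) : Set (Fin n → ℝ) :=
  {x | IsFaceOfDim P {x} 0}

/-- The graph of `P`: its vertices are the vertices of `P`, and two of them are adjacent when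
the segment joining them is a `1`-face of `P`. -/
def polytopeGraph {n : ℕ} (P : Set (Fin n → ℝ)) : SimpleGraph (vertices P) where
  Adj x y := x ≠ y ∧ IsFaceOfDim P (segment ℝ (x : Fin n → ℝ) (y : Fin n → ℝ)) 1
  symm := ⟨fun x y h => ⟨h.1.symm, by rw [segment_symm]; exact h.2⟩⟩
  loopless := ⟨fun _ h => h.1 rfl⟩

/-- `e(S, T)`: the number of edges of `G` with one endpoint in `S` and the other in `T`. -/
def numEdges {V : Type*} (G : SimpleGraph V) (S T : Set V) : ℕ :=
  {e ∈ G.edgeSet | ∃ x ∈ S, ∃ y ∈ T, e = s(x, y)}.ncard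

/-- The edge expansion `h(G)` of a finite graph `G`: the minimum of `e(S, V \ S) / |S|` over all
`S ⊆ V` with `1 ≤ |S| ≤ |V| / 2`. If `|V| ≤ 1` there is no such `S`, and the value is `0`. -/
def edgeExpansion {V : Type*} (G : SimpleGraph V) : ℝ :=
  sInf {r : ℝ | ∃ S : Set V, 1 ≤ S.ncard ∧ (S.ncard : ℝ) ≤ (Nat.card V : ℝ) / 2 ∧
    r = (numEdges G S Sᶜ : ℝ) / (S.ncard : ℝ)}

/-- The point of `{0,1}ⁿ ⊆ ℝⁿ` with the given bits. -/
def cubePoint {n : ℕ} (x : Fin n → Bool) : Fin n → ℝ :=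
  fun i => if x i then 1 else 0

/-- The `0/1`-polytope spanned by a set `U` of points of the cube. -/
def zeroOnePolytope {n : ℕ} (U : Set (Fin n → Bool)) : Set (Fin n → ℝ) :=
  convexHull ℝ (cubePoint '' U)

/-- The law of the random subset of `{0,1}ⁿ` that contains each point independently with
probability `p`. -/
def randomCubeSubset (n : ℕ) (p : unitInterval) : MeasureTheory.Measure (Set (Fin n → Bool)) :=
  ProbabilityTheory.setBernoulli Set.univ p

end RandomPolytope

end

/-! ### Faces of 0/1-polytopes and a combinatorial certificate for edges. -/

namespace RandomPolytope

/-! Choose `k` so that `p * 2 ^ (n - k)` lies between 60 and 120, and project the random set `U` to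
its first `k` coordinates. The fibres then have bounded mean size, and since `k ≥ n / 100 - 7`,
exceptional events of probability `O(2 ^ (-k))` disappear in the limit. With high probability two
things hold (`TypicalFibres`): every base point has at most `k / 20` empty neighbouring fibres, and
the sum of `256 ^ N` over the fibre sizes `N` is at most `K * 2 ^ k`, with `K` absolute. The rest of
the argument is deterministic.

Edges of the polytope come from minimal distances. If `v ∈ U` and a fibre over a cube neighbour of
its base point is nonempty, the point of that fibre nearest to `v` is adjacent to `v`. If a fibre
meets both `A` and `U \ A`, a nearest pair across the cut is adjacent. Call a base point full if its
nonempty fibre lies in `A`, and mixed if its fibre meets both sides. Every cube edge from full to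
occupied non-full points, or from mixed to occupied non-mixed points, yields its own cut edge of the
polytope (`cutEdges_fullBase_le`, `cutEdges_mixedBase_le`), and so does every mixed fibre
(`card_mixedBase_le`).

It remains to bound cube edges below in the presence of the sparse set `Z` of empty base points.
Assigning each point of `Z` to the side holding the majority of its neighbours at most doubles the
boundary (`cubeBoundary_fill_le`), so the classical edge-isoperimetric inequality applies. For small
sets its gain `log (2 ^ k / |S|)` outweighs the fibre sizes, which the exponential moment bounds on
average by the same logarithm (`two_mul_sum_le_cutEdges`); this gives expansion 1. For larger sets a
case distinction loses only a constant factor (`card_le_mul_card_cutPairs`). -/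

theorem setOf_mem_convexHull_and_dotProduct_eq {n : ℕ} {S : Set (Fin n → ℝ)} {c : Fin n → ℝ} {γ : ℝ}
    (h : ∀ x ∈ S, c ⬝ᵥ x ≤ γ) :
    {x ∈ convexHull ℝ S | c ⬝ᵥ x = γ} = convexHull ℝ {x ∈ S | c ⬝ᵥ x = γ} := by
  have hcomb : ∀ (a b : ℝ) (x y : Fin n → ℝ),
      c ⬝ᵥ (a • x + b • y) = a * (c ⬝ᵥ x) + b * (c ⬝ᵥ y) := by
    intro a b x y
    simp [dotProduct_add, dotProduct_smul]
  have hface : convexHull ℝ {x ∈ S | c ⬝ᵥ x = γ} ⊆ {x | c ⬝ᵥ x = γ} := by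
    refine convexHull_min (fun x hx => hx.2) ?_
    intro x hx y hy a b _ _ hab
    simp only [Set.mem_ofPred_eq] at hx hy ⊢
    rw [hcomb, hx, hy, ← add_mul, hab, one_mul]
  apply Set.Subset.antisymm
  -- A proper convex combination attains the maximum `γ` only if both points do, so adjoining the
  -- open half-space to the hull of the maximisers keeps it convex; this set contains `S`.
  · have hconv : Convex ℝ ({x | c ⬝ᵥ x < γ} ∪ convexHull ℝ {x ∈ S | c ⬝ᵥ x = γ}) := by
      rw [convex_iff_forall_pos]
      intro x hx y hy a b ha hb hab
      have key : ∀ x ∈ ({x | c ⬝ᵥ x < γ} ∪ convexHull ℝ {x ∈ S | c ⬝ᵥ x = γ}), c ⬝ᵥ x ≤ γ := by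
        rintro x (hx | hx)
        · exact le_of_lt hx
        · exact le_of_eq (hface hx)
      by_cases hlt : c ⬝ᵥ (a • x + b • y) < γ
      · exact Or.inl hlt
      · rw [hcomb] at hlt
        have hx' := key x hx
        have hy' := key y hy
        have hγ : a * γ + b * γ = γ := by rw [← add_mul, hab, one_mul]
        have h1 : ¬ c ⬝ᵥ x < γ := by
          intro hlt'
          apply hlt
          linarith [mul_lt_mul_of_pos_left hlt' ha, mul_le_mul_of_nonneg_left hy' hb.le]
        have h2 : ¬ c ⬝ᵥ y < γ := by
          intro hlt'
          apply hlt
          linarith [mul_lt_mul_of_pos_left hlt' hb, mul_le_mul_of_nonneg_left hx' ha.le]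
        exact Or.inr (convex_convexHull ℝ _ (hx.resolve_left h1) (hy.resolve_left h2) ha.le hb.le hab)
    have hsub : convexHull ℝ S ⊆ {x | c ⬝ᵥ x < γ} ∪ convexHull ℝ {x ∈ S | c ⬝ᵥ x = γ} := by
      refine convexHull_min (fun x hx => ?_) hconv
      rcases (h x hx).lt_or_eq with hlt | heq
      · exact Or.inl hlt
      · exact Or.inr (subset_convexHull ℝ _ ⟨hx, heq⟩)
    rintro x ⟨hx, hxc⟩
    exact (hsub hx).resolve_left (by simp [hxc])
  · intro x hx
    exact ⟨convexHull_mono (fun _ hy => hy.1) hx, hface hx⟩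

theorem dotProduct_le_of_mem_convexHull {n : ℕ} {S : Set (Fin n → ℝ)} {c : Fin n → ℝ} {γ : ℝ}
    (h : ∀ x ∈ S, c ⬝ᵥ x ≤ γ) : ∀ x ∈ convexHull ℝ S, c ⬝ᵥ x ≤ γ := by
  intro x hx
  refine convexHull_min (t := {x | c ⬝ᵥ x ≤ γ}) h ?_ hx
  intro x hx y hy a b ha hb hab
  simp only [Set.mem_ofPred_eq, dotProduct_add, dotProduct_smul, smul_eq_mul] at hx hy ⊢
  calc a * (c ⬝ᵥ x) + b * (c ⬝ᵥ y) ≤ a * γ + b * γ := by gcongr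
    _ = γ := by rw [← add_mul, hab, one_mul]

theorem cubePoint_injective {n : ℕ} : Function.Injective (cubePoint (n := n)) := by
  intro x y h
  funext i
  have := congrFun h i
  unfold cubePoint at this
  cases hx : x i <;> cases hy : y i <;> simp [hx, hy] at this ⊢

/-- On 0/1 points the indicator of `w j ≠ v j` is affine in `w j`. Hence faces can be exhibited by
weighted Hamming distances from `v`, with weights of either sign. -/
theorem exists_dotProduct_cubePoint {n : ℕ} (C : Fin n → ℝ) (v : Fin n → Bool) :
    ∃ (c : Fin n → ℝ) (γ : ℝ), ∀ w : Fin n → Bool,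
      c ⬝ᵥ cubePoint w = γ - ∑ j, if w j = v j then 0 else C j := by
  refine ⟨fun j => if v j then C j else - C j, ∑ j, if v j then C j else 0, fun w => ?_⟩
  rw [dotProduct, ← Finset.sum_sub_distrib]
  refine Finset.sum_congr rfl fun j _ => ?_
  unfold cubePoint
  cases hv : v j <;> cases hw : w j <;> simp

/-- If a weighted distance from `v` is nonnegative on `U` and vanishes on `T` only, then `T` spans
a face of the polytope of `U`. -/
theorem isFace_convexHull_of_weights {n : ℕ} {U T : Set (Fin n → Bool)} (hT : T ⊆ U)
    (C : Fin n → ℝ) (v : Fin n → Bool)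
    (h0 : ∀ w ∈ T, (∑ j, if w j = v j then 0 else C j) = 0)
    (h1 : ∀ w ∈ U, w ∉ T → 0 < ∑ j, if w j = v j then 0 else C j) :
    IsFace (zeroOnePolytope U) (convexHull ℝ (cubePoint '' T)) := by
  obtain ⟨c, γ, hc⟩ := exists_dotProduct_cubePoint C v
  have hle : ∀ x ∈ cubePoint '' U, c ⬝ᵥ x ≤ γ := by
    rintro _ ⟨w, hw, rfl⟩
    rw [hc]
    by_cases hwT : w ∈ T
    · rw [h0 w hwT]; simp
    · linarith [h1 w hw hwT]
  refine ⟨c, γ, dotProduct_le_of_mem_convexHull hle, ?_⟩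
  rw [zeroOnePolytope, setOf_mem_convexHull_and_dotProduct_eq hle]
  congr 1
  ext x
  constructor
  · rintro ⟨w, hw, rfl⟩
    exact ⟨⟨w, hT hw, rfl⟩, by rw [hc, h0 w hw]; simp⟩
  · rintro ⟨⟨w, hw, rfl⟩, hx⟩
    refine ⟨w, ?_, rfl⟩
    by_contra hwT
    have := h1 w hw hwT
    rw [hc] at hx
    linarith

theorem vertices_zeroOnePolytope {n : ℕ} (U : Set (Fin n → Bool)) :
    vertices (zeroOnePolytope U) = cubePoint '' U := by
  ext x
  constructor
  · rintro ⟨⟨c, γ, hle, hF⟩, -, -⟩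
    have hle' : ∀ x ∈ cubePoint '' U, c ⬝ᵥ x ≤ γ := fun x hx => hle x (subset_convexHull ℝ _ hx)
    rw [zeroOnePolytope, setOf_mem_convexHull_and_dotProduct_eq hle'] at hF
    have hne : {x ∈ cubePoint '' U | c ⬝ᵥ x = γ}.Nonempty := by
      rw [← convexHull_nonempty_iff (𝕜 := ℝ), ← hF]
      exact Set.singleton_nonempty x
    obtain ⟨y, hy⟩ := hne
    have : y ∈ ({x} : Set (Fin n → ℝ)) := by
      rw [hF]; exact subset_convexHull ℝ _ hy
    rw [Set.mem_singleton_iff] at this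
    exact this ▸ hy.1
  · rintro ⟨v, hv, rfl⟩
    refine ⟨?_, Set.singleton_nonempty _, ?_⟩
    · have := isFace_convexHull_of_weights (U := U) (T := {v}) (by simpa using hv) (fun _ => 1) v
        (by simp) ?_
      · simpa using this
      · intro w _ hwv
        obtain ⟨j, hj⟩ : ∃ j, w j ≠ v j := by
          by_contra! hcon
          exact hwv (funext hcon)
        exact Finset.sum_pos' (fun j _ => by split_ifs <;> norm_num)
          ⟨j, Finset.mem_univ _, by simp [hj]⟩
    · simp [direction_affineSpan]

/-- A combinatorial certificate for `u` and `v` to be adjacent on the polytope of `U`: some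
coordinate `i` separates them, and `u` is the only point of `U` that lies on the side of `u` in
direction `i` and in the smallest face of the cube containing `u` and `v`. -/
def CubeAdj {n : ℕ} (U : Set (Fin n → Bool)) (u v : Fin n → Bool) : Prop :=
  ∃ i, u i ≠ v i ∧ ∀ w ∈ U, (∀ j, u j = v j → w j = v j) → w i = u i → w = u

theorem isFaceOfDim_segment_of_cubeAdj {n : ℕ} {U : Set (Fin n → Bool)} {u v : Fin n → Bool}
    (hu : u ∈ U) (hv : v ∈ U) (h : CubeAdj U u v) :
    IsFaceOfDim (zeroOnePolytope U) (segment ℝ (cubePoint u) (cubePoint v)) 1 := by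
  obtain ⟨i, hi, huniq⟩ := h
  have hne : cubePoint u ≠ cubePoint v := fun h => hi (congrFun (cubePoint_injective h) i)
  refine ⟨?_, ⟨_, left_mem_segment ℝ _ _⟩, ?_⟩
  · have hseg : segment ℝ (cubePoint u) (cubePoint v) = convexHull ℝ (cubePoint '' {u, v}) := by
      rw [Set.image_pair, convexHull_pair]
    rw [hseg]
    set D : ℝ := ∑ j ∈ Finset.univ.erase i, if u j = v j then 0 else 1 with hD
    have hDn : D ≤ n := by
      calc D ≤ ∑ j ∈ Finset.univ.erase i, (1 : ℝ) := by
            apply Finset.sum_le_sum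
            intro j _
            split_ifs <;> norm_num
        _ ≤ n := by
            rw [Finset.sum_const, nsmul_eq_mul, mul_one]
            exact_mod_cast (Finset.card_le_univ _).trans (by simp)
    -- `D` counts the other coordinates in which `u` and `v` differ, so the weight `-D` in direction
    -- `i` puts `u` at weighted distance 0, like `v`. A coordinate shared by `u` and `v` costs `n +
    -- 1 > D`, so leaving their common cube face is never compensated.
    set C : Fin n → ℝ := fun j => if j = i then -D else if u j = v j then n + 1 else 1 with hC
    have hsplit : ∀ w : Fin n → Bool, (∑ j, if w j = v j then 0 else C j) =
        (if w i = v i then 0 else -D) +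
          ∑ j ∈ Finset.univ.erase i, if w j = v j then 0 else C j := by
      intro w
      rw [← Finset.add_sum_erase _ _ (Finset.mem_univ i)]
      simp [hC]
    have hCpos : ∀ j, j ≠ i → 1 ≤ C j := by
      intro j hj
      simp only [hC, if_neg hj]
      split_ifs
      · linarith [Nat.cast_nonneg (α := ℝ) n]
      · exact le_rfl
    have hnn : ∀ w : Fin n → Bool, ∀ j ∈ Finset.univ.erase i,
        0 ≤ if w j = v j then 0 else C j := by
      intro w j hj
      split_ifs
      · exact le_rfl
      · linarith [hCpos j (Finset.ne_of_mem_erase hj)]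
    refine isFace_convexHull_of_weights (by rintro w (rfl | rfl) <;> assumption) C v ?_ ?_
    · rintro w (rfl | rfl)
      · rw [hsplit, if_neg hi]
        have : (∑ j ∈ Finset.univ.erase i, if w j = v j then 0 else C j) = D := by
          refine Finset.sum_congr rfl fun j hj => ?_
          split_ifs with hwv
          · rfl
          · simp [hC, hwv, Finset.ne_of_mem_erase hj]
        rw [this]; ring
      · simp
    · intro w hw hwT
      simp only [Set.mem_insert_iff, Set.mem_singleton_iff, not_or] at hwT
      rw [hsplit]
      by_cases hwi : w i = v i
      · rw [if_pos hwi, zero_add]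
        obtain ⟨j, hj⟩ : ∃ j, w j ≠ v j := by
          by_contra! hcon
          exact hwT.2 (funext hcon)
        have hji : j ≠ i := fun h => hj (h ▸ hwi)
        exact Finset.sum_pos' (hnn w) ⟨j, by simp [hji], by
          rw [if_neg hj]; linarith [hCpos j hji]⟩
      · rw [if_neg hwi]
        have hwu : w i = u i :=
          (by decide : ∀ a b c : Bool, c ≠ b → a ≠ b → a = c) (w i) (v i) (u i) hi hwi
        obtain ⟨j, hj1, hj2⟩ : ∃ j, u j = v j ∧ w j ≠ v j := by
          by_contra! hcon
          exact hwT.1 (huniq w hw hcon hwu)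
        have hji : j ≠ i := fun h => hi (h ▸ hj1)
        have := Finset.single_le_sum (hnn w) (Finset.mem_erase.2 ⟨hji, Finset.mem_univ j⟩)
        rw [if_neg hj2] at this
        simp only [hC, if_neg hji, if_pos hj1] at this
        linarith
  · rw [← convexHull_pair, affineSpan_convexHull, direction_affineSpan, vectorSpan_pair_rev]
    exact finrank_span_singleton (by simpa [sub_eq_zero] using hne.symm)

end RandomPolytope

/-! ### Edge isoperimetry in the cube. -/

namespace RandomPolytope

/-- The neighbour of `x` in the cube in direction `i`. -/
def flip {k : ℕ} (x : Fin k → Bool) (i : Fin k) : Fin k → Bool :=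
  Function.update x i (!x i)

theorem flip_cons_zero {k : ℕ} (b : Bool) (x : Fin k → Bool) :
    flip (Fin.cons b x : Fin (k + 1) → Bool) 0 = Fin.cons (!b) x := by
  simp [flip, Fin.update_cons_zero]

theorem flip_cons_succ {k : ℕ} (b : Bool) (x : Fin k → Bool) (i : Fin k) :
    flip (Fin.cons b x : Fin (k + 1) → Bool) i.succ = Fin.cons b (flip x i) := by
  simp [flip, Fin.cons_update]

@[simp] theorem flip_flip {k : ℕ} (x : Fin k → Bool) (i : Fin k) : flip (flip x i) i = x := by
  simp [flip]

theorem flip_comm {k : ℕ} (x : Fin k → Bool) (i j : Fin k) :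
    flip (flip x i) j = flip (flip x j) i := by
  rcases eq_or_ne i j with rfl | h
  · rfl
  · simp [flip, Function.update_of_ne h, Function.update_of_ne h.symm, Function.update_comm h]

theorem flip_apply_self {k : ℕ} (x : Fin k → Bool) (i : Fin k) : flip x i i = !x i := by
  simp [flip]

theorem flip_apply_of_ne {k : ℕ} (x : Fin k → Bool) {i j : Fin k} (h : j ≠ i) :
    flip x i j = x j := by
  simp [flip, h]

theorem flip_injective {k : ℕ} (i : Fin k) : Function.Injective fun x : Fin k → Bool => flip x i :=
  fun x y h => by simpa using congrArg (fun z => flip z i) h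

theorem flip_right_injective {k : ℕ} (x : Fin k → Bool) : Function.Injective (flip x) := by
  intro i j h
  by_contra hij
  have := congrFun h i
  rw [flip_apply_self, flip_apply_of_ne x hij] at this
  cases hx : x i <;> simp [hx] at this

open Classical in
/-- The number of edges of the cube with exactly one endpoint in `T`. -/
def cubeBoundary {k : ℕ} (T : Finset (Fin k → Bool)) : ℕ :=
  ∑ x, ∑ i, if x ∈ T ∧ flip x i ∉ T then 1 else 0

/-- By concavity the entropy lies above its chord between 0 and 1/2. -/
theorem two_mul_mul_log_two_le_binEntropy {t : ℝ} (h0 : 0 ≤ t) (h1 : t ≤ 1 / 2) :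
    2 * t * Real.log 2 ≤ Real.binEntropy t := by
  have h := Real.strictConcave_binEntropy.concaveOn.2
    (show (1 / 2 : ℝ) ∈ Set.Icc 0 1 by norm_num) (show (0 : ℝ) ∈ Set.Icc 0 1 by norm_num)
    (show 0 ≤ 2 * t by linarith) (show 0 ≤ 1 - 2 * t by linarith) (by ring)
  have h2 : Real.binEntropy (1 / 2) = Real.log 2 := by
    rw [one_div]; exact Real.binEntropy_two_inv
  simp only [smul_eq_mul, Real.binEntropy_zero, mul_zero, add_zero, h2] at h
  calc _ ≤ _ := h
    _ = _ := by congr 1; ring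

/-- The entropy bound at `t = a / (a + b)`, scaled by `a + b`. With `a` and `b` the sizes of two
opposite slices, it is the induction step of the isoperimetric inequality. -/
theorem mul_log_add_mul_log_le {a b : ℝ} (ha : 0 ≤ a) (hab : a ≤ b) :
    a * Real.log a + b * Real.log b + 2 * a * Real.log 2 ≤ (a + b) * Real.log (a + b) := by
  rcases ha.eq_or_lt with rfl | ha
  · simp
  have hb : 0 < b := ha.trans_le hab
  have hs : 0 < a + b := by linarith
  have h := two_mul_mul_log_two_le_binEntropy (t := a / (a + b)) (by positivity)
    (by rw [div_le_iff₀ hs]; linarith)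
  have h1 : 1 - a / (a + b) = b / (a + b) := by field_simp; ring
  rw [Real.binEntropy, h1, inv_div, inv_div, Real.log_div hs.ne' ha.ne',
    Real.log_div hs.ne' hb.ne'] at h
  have h2 := mul_le_mul_of_nonneg_left h hs.le
  have e1 : (a + b) * (2 * (a / (a + b)) * Real.log 2) = 2 * a * Real.log 2 := by
    field_simp
  have e2 : (a + b) * (a / (a + b) * (Real.log (a + b) - Real.log a) +
      b / (a + b) * (Real.log (a + b) - Real.log b)) =
      a * (Real.log (a + b) - Real.log a) + b * (Real.log (a + b) - Real.log b) := by
    field_simp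
  rw [e1, e2] at h2
  linarith

open Classical in
theorem sum_cons {k : ℕ} {M : Type*} [AddCommMonoid M] (f : (Fin (k + 1) → Bool) → M) :
    ∑ x, f x = (∑ x : Fin k → Bool, f (Fin.cons true x)) + ∑ x : Fin k → Bool, f (Fin.cons false x) := by
  rw [← (Fin.consEquiv (fun _ : Fin (k + 1) => Bool)).sum_comp, Fintype.sum_prod_type,
    Fintype.sum_bool]
  rfl

open Classical in
theorem card_cons_slices {k : ℕ} (T : Finset (Fin (k + 1) → Bool)) :
    T.card = (Finset.univ.filter fun x : Fin k → Bool => (Fin.cons true x : Fin (k + 1) → Bool) ∈ T).card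
      + (Finset.univ.filter fun x : Fin k → Bool => (Fin.cons false x : Fin (k + 1) → Bool) ∈ T).card := by
  rw [Finset.card_filter, Finset.card_filter, ← sum_cons fun x => if x ∈ T then 1 else 0]
  simp

open Classical in
theorem cubeBoundary_cons {k : ℕ} (T : Finset (Fin (k + 1) → Bool)) :
    cubeBoundary (Finset.univ.filter fun x : Fin k → Bool => (Fin.cons true x : Fin (k + 1) → Bool) ∈ T)
      + cubeBoundary (Finset.univ.filter fun x : Fin k → Bool => (Fin.cons false x : Fin (k + 1) → Bool) ∈ T)
      + (((Finset.univ.filter fun x : Fin k → Bool => (Fin.cons true x : Fin (k + 1) → Bool) ∈ T) \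
          (Finset.univ.filter fun x : Fin k → Bool => (Fin.cons false x : Fin (k + 1) → Bool) ∈ T)).card
      + ((Finset.univ.filter fun x : Fin k → Bool => (Fin.cons false x : Fin (k + 1) → Bool) ∈ T) \
          (Finset.univ.filter fun x : Fin k → Bool => (Fin.cons true x : Fin (k + 1) → Bool) ∈ T)).card)
      = cubeBoundary T := by
  simp only [cubeBoundary, sum_cons, Fin.sum_univ_succ, flip_cons_zero, flip_cons_succ,
    Finset.mem_filter, Finset.mem_univ, true_and, Bool.not_true, Bool.not_false,
    Finset.sum_add_distrib]
  have hc : ∀ A B : Finset (Fin k → Bool), (A \ B).card = ∑ x, if x ∈ A ∧ x ∉ B then 1 else 0 := by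
    intro A B
    rw [← Finset.card_filter]
    congr 1
    ext x
    simp
  simp only [hc, Finset.mem_filter, Finset.mem_univ, true_and]
  ring

/-- The edge-isoperimetric inequality in the cube. -/
theorem mul_log_le_cubeBoundary {k : ℕ} (T : Finset (Fin k → Bool)) :
    (T.card : ℝ) * (k * Real.log 2 - Real.log T.card) ≤ cubeBoundary T * Real.log 2 := by
  classical
  have hL := Real.log_pos one_lt_two
  induction k with
  | zero =>
    have h : T.card ≤ 1 := by
      simpa using Finset.card_le_univ T
    have h2 : (T.card : ℝ) * ((0 : ℕ) * Real.log 2 - Real.log T.card) = 0 := by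
      interval_cases h3 : T.card <;> simp
    rw [h2]
    positivity
  | succ k ih =>
    rw [← cubeBoundary_cons, card_cons_slices]
    set T1 := Finset.univ.filter fun x : Fin k → Bool => (Fin.cons true x : Fin (k + 1) → Bool) ∈ T
    set T0 := Finset.univ.filter fun x : Fin k → Bool => (Fin.cons false x : Fin (k + 1) → Bool) ∈ T
    have i1 := ih T1
    have i0 := ih T0
    -- The boundary edges joining the two slices number at least the difference of the slice sizes.
    have d1 : (T1.card : ℝ) - T0.card ≤ (T1 \ T0).card := by
      rw [sub_le_iff_le_add]
      exact_mod_cast Nat.sub_le_iff_le_add.1 (Finset.le_card_sdiff T0 T1)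
    have d0 : (T0.card : ℝ) - T1.card ≤ (T0 \ T1).card := by
      rw [sub_le_iff_le_add]
      exact_mod_cast Nat.sub_le_iff_le_add.1 (Finset.le_card_sdiff T1 T0)
    have n1 : (0 : ℝ) ≤ (T1 \ T0).card := Nat.cast_nonneg _
    have n0 : (0 : ℝ) ≤ (T0 \ T1).card := Nat.cast_nonneg _
    push_cast
    rcases le_total (T1.card : ℝ) T0.card with h | h
    · have := mul_log_add_mul_log_le (Nat.cast_nonneg _) h
      have := mul_le_mul_of_nonneg_right d0 hL.le
      have := mul_nonneg n1 hL.le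
      linarith
    · have := mul_log_add_mul_log_le (Nat.cast_nonneg _) h
      rw [add_comm (T0.card : ℝ)] at this
      have := mul_le_mul_of_nonneg_right d1 hL.le
      have := mul_nonneg n0 hL.le
      linarith

end RandomPolytope

/-! ### Isoperimetry in the cube with a sparse set removed. -/

namespace RandomPolytope

open Classical in
/-- The number of cube neighbours of `x` in `S`. -/
def degInto {k : ℕ} (S : Finset (Fin k → Bool)) (x : Fin k → Bool) : ℕ :=
  ∑ i, if flip x i ∈ S then 1 else 0

open Classical in
/-- The number of pairs of cube neighbours `(x, y)` with `x ∈ S` and `y ∈ T`. -/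
def cutEdges {k : ℕ} (S T : Finset (Fin k → Bool)) : ℕ :=
  ∑ x, ∑ i, if x ∈ S ∧ flip x i ∈ T then 1 else 0

theorem sum_flip {k : ℕ} {M : Type*} [AddCommMonoid M] (f : (Fin k → Bool) → Fin k → M) :
    ∑ x, ∑ i, f (flip x i) i = ∑ x, ∑ i, f x i := by
  classical
  rw [Finset.sum_comm, Finset.sum_comm (f := f)]
  refine Finset.sum_congr rfl fun i _ => ?_
  exact (Equiv.ofBijective (fun x : Fin k → Bool => flip x i)
    (Finite.injective_iff_bijective.1 (flip_injective i))).sum_comp (fun x => f x i)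

theorem cutEdges_comm {k : ℕ} (S T : Finset (Fin k → Bool)) : cutEdges S T = cutEdges T S := by
  classical
  unfold cutEdges
  rw [← sum_flip]
  simp only [flip_flip, and_comm]

theorem sum_mem_eq_sum_ite {α M : Type*} [Fintype α] [AddCommMonoid M] (Z : Finset α)
    [DecidablePred (· ∈ Z)] (f : α → M) : ∑ z ∈ Z, f z = ∑ z, if z ∈ Z then f z else 0 := by
  rw [← Finset.sum_filter]
  congr 1
  ext
  simp

theorem cutEdges_eq_sum {k : ℕ} (S T : Finset (Fin k → Bool)) :
    cutEdges S T = ∑ x ∈ S, degInto T x := by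
  classical
  unfold cutEdges degInto
  simp only [ite_and, Finset.sum_ite_irrel, Finset.sum_const_zero, Finset.sum_ite_mem, Finset.univ_inter]

-- Counts paths from `Z` to `R` to `Q` by their last edge: each edge from `R` to `Q` extends
-- backwards into `Z` in at most `D` ways.
open Classical in
theorem sum_paths_le {k D : ℕ} {Z : Finset (Fin k → Bool)} (hD : ∀ x, degInto Z x ≤ D)
    (R Q : Finset (Fin k → Bool)) :
    (∑ z, ∑ i, ∑ j, if z ∈ Z ∧ flip z i ∈ R ∧ flip (flip z i) j ∈ Q then 1 else 0)
      ≤ D * cutEdges R Q := by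
  rw [← sum_flip]
  simp only [flip_flip]
  unfold cutEdges
  rw [Finset.mul_sum]
  refine Finset.sum_le_sum fun u _ => ?_
  calc _ = degInto Z u * ∑ j, if u ∈ R ∧ flip u j ∈ Q then 1 else 0 := by
        unfold degInto
        rw [Finset.sum_mul_sum]
        refine Finset.sum_congr rfl fun i _ => Finset.sum_congr rfl fun j _ => ?_
        by_cases h1 : flip u i ∈ Z <;> simp [h1]
    _ ≤ _ := Nat.mul_le_mul_right _ (hD u)

/-- `R`, `Q`, `Z` partition the cube, and every point has few neighbours in `Z`. -/
structure SparsePartition {k : ℕ} (D : ℕ) (R Q Z : Finset (Fin k → Bool)) : Prop where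
  cover : ∀ x, x ∈ R ∨ x ∈ Q ∨ x ∈ Z
  notMem_RQ : ∀ x, x ∈ R → x ∉ Q
  notMem_RZ : ∀ x, x ∈ R → x ∉ Z
  notMem_QZ : ∀ x, x ∈ Q → x ∉ Z
  deg_le : ∀ x, degInto Z x ≤ D
  le_dim : 20 * D ≤ k

namespace SparsePartition

variable {k D : ℕ} {R Q Z : Finset (Fin k → Bool)}

theorem symm (h : SparsePartition D R Q Z) : SparsePartition D Q R Z where
  cover x := by rcases h.cover x with h | h | h <;> simp [h]
  notMem_RQ x hx hx' := h.notMem_RQ x hx' hx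
  notMem_RZ := h.notMem_QZ
  notMem_QZ := h.notMem_RZ
  deg_le := h.deg_le
  le_dim := h.le_dim

theorem deg_add (h : SparsePartition D R Q Z) (x : Fin k → Bool) :
    degInto R x + degInto Q x + degInto Z x = k := by
  classical
  unfold degInto
  rw [← Finset.sum_add_distrib, ← Finset.sum_add_distrib]
  have : ∀ i, ((if flip x i ∈ R then 1 else 0) + (if flip x i ∈ Q then 1 else 0) +
      if flip x i ∈ Z then 1 else 0) = 1 := by
    intro i
    have h1 := h.notMem_RQ (flip x i)
    have h2 := h.notMem_RZ (flip x i)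
    have h3 := h.notMem_QZ (flip x i)
    rcases h.cover (flip x i) with h' | h' | h'
    · simp [h', h1 h', h2 h']
    · have h4 : flip x i ∉ R := fun hR => h1 hR h'
      simp [h', h3 h', h4]
    · have h4 : flip x i ∉ R := fun hR => h2 hR h'
      have h5 : flip x i ∉ Q := fun hQ => h3 hQ h'
      simp [h', h4, h5]
  simp [this]

/-- The larger degree is at least `(k - D) / 2`, and `20 * D ≤ k` gives `(k - D) / 2 - D ≥ 17 * k /
40`. -/
theorem mul_min_le_of_le (h : SparsePartition D R Q Z) (z : Fin k → Bool)
    (hle : degInto R z ≤ degInto Q z) :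
    17 * k * degInto R z ≤ 40 * (degInto R z * (degInto Q z - D)) := by
  have h1 := h.deg_add z
  have h2 := h.deg_le z
  have h3 := h.le_dim
  have h4 : 17 * k ≤ 40 * (degInto Q z - D) := by omega
  calc 17 * k * degInto R z ≤ 40 * (degInto Q z - D) * degInto R z := Nat.mul_le_mul_right _ h4
    _ = _ := by ring

-- The right side counts squares with corner `z`, one neighbour in `R`, the other in `Q`, and fourth
-- corner outside `Z`. For a fixed neighbour in `R`, at most `D` directions put the fourth corner
-- into `Z`.
open Classical in
theorem deg_mul_sub_le (h : SparsePartition D R Q Z) (z : Fin k → Bool) :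
    degInto R z * (degInto Q z - D) ≤
      ∑ i, ∑ j, if flip z i ∈ R ∧ flip z j ∈ Q ∧ flip (flip z i) j ∉ Z then 1 else 0 := by
  rw [degInto, Finset.sum_mul]
  refine Finset.sum_le_sum fun i _ => ?_
  by_cases hi : flip z i ∈ R
  · rw [if_pos hi, one_mul, Nat.sub_le_iff_le_add]
    calc degInto Q z ≤ (∑ j, if flip z i ∈ R ∧ flip z j ∈ Q ∧ flip (flip z i) j ∉ Z then 1 else 0)
          + degInto Z (flip z i) := by
          unfold degInto
          rw [← Finset.sum_add_distrib]
          refine Finset.sum_le_sum fun j _ => ?_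
          by_cases h1 : flip z j ∈ Q <;> by_cases h2 : flip (flip z i) j ∈ Z <;> simp [h1, h2, hi]
      _ ≤ _ := Nat.add_le_add_left (h.deg_le _) _
  · simp [hi]

open Classical in
theorem mul_min_deg_le (h : SparsePartition D R Q Z) (z : Fin k → Bool) :
    17 * k * min (degInto R z) (degInto Q z) ≤
      40 * ∑ i, ∑ j, if flip z i ∈ R ∧ flip z j ∈ Q ∧ flip (flip z i) j ∉ Z then 1 else 0 := by
  rcases le_total (degInto R z) (degInto Q z) with hle | hle
  · rw [min_eq_left hle]
    exact (h.mul_min_le_of_le z hle).trans (Nat.mul_le_mul_left _ (h.deg_mul_sub_le z))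
  · rw [min_eq_right hle]
    refine (h.symm.mul_min_le_of_le z hle).trans (Nat.mul_le_mul_left _ ?_)
    refine (h.symm.deg_mul_sub_le z).trans (le_of_eq ?_)
    rw [Finset.sum_comm]
    refine Finset.sum_congr rfl fun i _ => Finset.sum_congr rfl fun j _ => ?_
    rw [flip_comm z j i]
    congr 1
    exact propext ⟨fun ⟨a, b, c⟩ => ⟨b, a, c⟩, fun ⟨a, b, c⟩ => ⟨b, a, c⟩⟩

/-- The fourth corner of each counted square lies in `R` or `Q`, so the square contains a path from
`z` ending in an edge between `R` and `Q`. There are at most `D` such paths per edge and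
orientation. -/
theorem mul_sum_min_deg_le (h : SparsePartition D R Q Z) :
    17 * k * ∑ z ∈ Z, min (degInto R z) (degInto Q z) ≤ 80 * D * cutEdges R Q := by
  classical
  have key : ∑ z ∈ Z, ∑ i, ∑ j,
      (if flip z i ∈ R ∧ flip z j ∈ Q ∧ flip (flip z i) j ∉ Z then 1 else 0) ≤
      D * cutEdges R Q + D * cutEdges Q R := by
    calc _ ≤ ∑ z, ∑ i, ∑ j,
            ((if z ∈ Z ∧ flip z i ∈ R ∧ flip (flip z i) j ∈ Q then 1 else 0) +
              if z ∈ Z ∧ flip z j ∈ Q ∧ flip (flip z j) i ∈ R then 1 else 0) := by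
          rw [sum_mem_eq_sum_ite Z]
          refine Finset.sum_le_sum fun z _ => ?_
          by_cases hz : z ∈ Z
          · rw [if_pos hz]
            refine Finset.sum_le_sum fun i _ => Finset.sum_le_sum fun j _ => ?_
            rw [flip_comm z j i]
            split_ifs with h1 h2 h3 h3 <;> try omega
            exfalso
            rcases h.cover (flip (flip z i) j) with h' | h' | h'
            · exact h3 ⟨hz, h1.2.1, h'⟩
            · exact h2 ⟨hz, h1.1, h'⟩
            · exact h1.2.2 h'
          · simp [hz]
      _ = (∑ z, ∑ i, ∑ j, if z ∈ Z ∧ flip z i ∈ R ∧ flip (flip z i) j ∈ Q then 1 else 0) +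
            ∑ z, ∑ i, ∑ j, if z ∈ Z ∧ flip z i ∈ Q ∧ flip (flip z i) j ∈ R then 1 else 0 := by
          simp only [Finset.sum_add_distrib]
          congr 1
          refine Finset.sum_congr rfl fun z _ => ?_
          rw [Finset.sum_comm]
      _ ≤ _ := Nat.add_le_add (sum_paths_le h.deg_le R Q) (sum_paths_le h.deg_le Q R)
  rw [cutEdges_comm Q R] at key
  rw [Finset.mul_sum]
  calc _ ≤ ∑ z ∈ Z, 40 * ∑ i, ∑ j,
        (if flip z i ∈ R ∧ flip z j ∈ Q ∧ flip (flip z i) j ∉ Z then 1 else 0) :=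
        Finset.sum_le_sum fun z _ => h.mul_min_deg_le z
    _ ≤ 40 * (D * cutEdges R Q + D * cutEdges R Q) := by
        rw [← Finset.mul_sum]; exact Nat.mul_le_mul_left _ key
    _ = _ := by ring

open Classical in
/-- `R` together with the points of `Z` most of whose neighbours outside `Z` lie in `R`. -/
def fill (R Q Z : Finset (Fin k → Bool)) : Finset (Fin k → Bool) :=
  R ∪ Z.filter fun z => degInto Q z < degInto R z

theorem mem_fill {x : Fin k → Bool} :
    x ∈ fill R Q Z ↔ x ∈ R ∨ x ∈ Z ∧ degInto Q x < degInto R x := by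
  classical
  simp [fill]

/-- An added point has at least `max D 1` neighbours in `R`, while a point of `R` has at most `D`
neighbours in `Z`; double counting shows that at most `R.card` points are added. -/
theorem card_fill_le (h : SparsePartition D R Q Z) : (fill R Q Z).card ≤ 2 * R.card := by
  classical
  have h1 : ∑ z ∈ Z.filter fun z => degInto Q z < degInto R z, degInto R z ≤ R.card * D := by
    calc _ ≤ ∑ z ∈ Z, degInto R z := Finset.sum_le_sum_of_subset (Finset.filter_subset _ _)
      _ = ∑ x ∈ R, degInto Z x := by rw [← cutEdges_eq_sum, cutEdges_comm, cutEdges_eq_sum]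
      _ ≤ _ := by
        rw [← smul_eq_mul]
        exact Finset.sum_le_card_nsmul _ _ _ fun x _ => h.deg_le x
  have h2 : (Z.filter fun z => degInto Q z < degInto R z).card * max D 1 ≤
      ∑ z ∈ Z.filter fun z => degInto Q z < degInto R z, degInto R z := by
    rw [← smul_eq_mul]
    refine Finset.card_nsmul_le_sum _ _ _ fun z hz => ?_
    have := (Finset.mem_filter.1 hz).2
    have := h.deg_add z
    have := h.deg_le z
    have := h.le_dim
    omega
  have h3 : (Z.filter fun z => degInto Q z < degInto R z).card ≤ R.card := by
    have h4 : (Z.filter fun z => degInto Q z < degInto R z).card * max D 1 ≤ R.card * max D 1 :=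
      (h2.trans h1).trans (Nat.mul_le_mul_left _ (le_max_left _ _))
    exact Nat.le_of_mul_le_mul_right h4 (by positivity)
  calc (fill R Q Z).card ≤ R.card + (Z.filter fun z => degInto Q z < degInto R z).card :=
        Finset.card_union_le _ _
    _ ≤ _ := by omega

theorem card_fill_add_card_le (h : SparsePartition D R Q Z) :
    (fill R Q Z).card + Q.card ≤ 2 ^ k := by
  classical
  rw [← Finset.card_union_of_disjoint]
  · simpa using Finset.card_le_univ (fill R Q Z ∪ Q)
  · rw [Finset.disjoint_left]
    intro x hx hxQ
    rcases mem_fill.1 hx with hx | hx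
    · exact h.notMem_RQ x hx hxQ
    · exact h.notMem_QZ x hxQ hx.1

-- Let `z` and `flip z i` be neighbours in `Z` assigned to different sides. Moving the more than `19
-- * k / 40` neighbours of `z` in `R` along direction `i`, at most `k / 20` land in `Z`. So either
-- at least `k / 10` land in `Q`, each giving a path, or `flip z i` has at least `3 * k / 10`
-- neighbours in its minority side `R`.
open Classical in
theorem mul_indicator_le (h : SparsePartition D R Q Z) (z : Fin k → Bool) (i : Fin k) :
    k * (if z ∈ Z ∧ flip z i ∈ Z ∧ degInto Q z < degInto R z ∧
        degInto R (flip z i) ≤ degInto Q (flip z i) then 1 else 0) ≤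
      10 * (∑ j, if z ∈ Z ∧ flip z j ∈ R ∧ flip (flip z j) i ∈ Q then 1 else 0) +
      k * (if flip z i ∈ Z ∧ z ∈ Z ∧
        3 * k ≤ 10 * min (degInto R (flip z i)) (degInto Q (flip z i)) then 1 else 0) := by
  by_cases hc : z ∈ Z ∧ flip z i ∈ Z ∧ degInto Q z < degInto R z ∧
        degInto R (flip z i) ≤ degInto Q (flip z i)
  swap
  · simp [hc]
  obtain ⟨hz, hz', hmaj, hmin⟩ := hc
  have hr : degInto R z ≤ degInto R (flip z i) +
      (∑ j, if z ∈ Z ∧ flip z j ∈ R ∧ flip (flip z j) i ∈ Q then 1 else 0) +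
      degInto Z (flip z i) := by
    unfold degInto
    rw [← Finset.sum_add_distrib, ← Finset.sum_add_distrib]
    refine Finset.sum_le_sum fun j _ => ?_
    rw [flip_comm z i j]
    rcases h.cover (flip (flip z j) i) with h' | h' | h' <;> by_cases h1 : flip z j ∈ R <;>
      simp only [h', h1, hz, true_and, if_true, if_false] <;> omega
  have := h.deg_add z
  have := h.deg_le z
  have := h.deg_le (flip z i)
  have := h.le_dim
  simp only [hz, hz', hmaj, hmin, true_and, and_true, if_true, min_eq_left hmin, mul_one] at hr ⊢
  split_ifs <;> omega

open Classical in
theorem mul_sum_indicator_le (h : SparsePartition D R Q Z) :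
    6 * k * (∑ z, ∑ i, if z ∈ Z ∧ flip z i ∈ Z ∧ degInto Q z < degInto R z ∧
        degInto R (flip z i) ≤ degInto Q (flip z i) then 1 else 0) ≤
      60 * D * cutEdges R Q + k * ∑ z ∈ Z, min (degInto R z) (degInto Q z) := by
  have h1 : (∑ z, ∑ i, ∑ j, if z ∈ Z ∧ flip z j ∈ R ∧ flip (flip z j) i ∈ Q then 1 else 0) ≤
      D * cutEdges R Q := by
    refine le_trans (le_of_eq ?_) (sum_paths_le h.deg_le R Q)
    exact Finset.sum_congr rfl fun z _ => Finset.sum_comm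
  -- A point whose minority degree is at least `3 * k / 10` has at most `k / 20` neighbours in `Z`,
  -- which is a sixth of that.
  have h2 : (6 * ∑ z, ∑ i, if flip z i ∈ Z ∧ z ∈ Z ∧
        3 * k ≤ 10 * min (degInto R (flip z i)) (degInto Q (flip z i)) then 1 else 0) ≤
      ∑ z ∈ Z, min (degInto R z) (degInto Q z) := by
    have hflip : (∑ z, ∑ i, if flip z i ∈ Z ∧ z ∈ Z ∧
        3 * k ≤ 10 * min (degInto R (flip z i)) (degInto Q (flip z i)) then 1 else 0) =
        ∑ z, ∑ i, if z ∈ Z ∧ flip z i ∈ Z ∧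
          3 * k ≤ 10 * min (degInto R z) (degInto Q z) then 1 else 0 := by
      rw [← sum_flip]
      simp only [flip_flip]
    rw [hflip, sum_mem_eq_sum_ite Z, Finset.mul_sum]
    refine Finset.sum_le_sum fun z _ => ?_
    by_cases hz : z ∈ Z ∧ 3 * k ≤ 10 * min (degInto R z) (degInto Q z)
    · simp only [hz, true_and, and_true, if_true]
      have := h.deg_le z
      have := h.le_dim
      change 6 * degInto Z z ≤ _
      omega
    · rw [Finset.sum_eq_zero]
      · simp
      · intro i _
        rw [if_neg]
        exact fun h => hz ⟨h.1, h.2.2⟩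
  calc _ = 6 * ∑ z, ∑ i, k * (if z ∈ Z ∧ flip z i ∈ Z ∧ degInto Q z < degInto R z ∧
        degInto R (flip z i) ≤ degInto Q (flip z i) then 1 else 0) := by
        simp only [← Finset.mul_sum]; ring
    _ ≤ 6 * ∑ z, ∑ i, (10 * (∑ j, if z ∈ Z ∧ flip z j ∈ R ∧ flip (flip z j) i ∈ Q then 1 else 0) +
      k * (if flip z i ∈ Z ∧ z ∈ Z ∧
        3 * k ≤ 10 * min (degInto R (flip z i)) (degInto Q (flip z i)) then 1 else 0)) :=
        Nat.mul_le_mul_left _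
          (Finset.sum_le_sum fun z _ => Finset.sum_le_sum fun i _ => h.mul_indicator_le z i)
    _ = 60 * (∑ z, ∑ i, ∑ j, if z ∈ Z ∧ flip z j ∈ R ∧ flip (flip z j) i ∈ Q then 1 else 0) +
        k * (6 * ∑ z, ∑ i, if flip z i ∈ Z ∧ z ∈ Z ∧
        3 * k ≤ 10 * min (degInto R (flip z i)) (degInto Q (flip z i)) then 1 else 0) := by
        simp only [Finset.sum_add_distrib, ← Finset.mul_sum]; ring
    _ ≤ 60 * (D * cutEdges R Q) + k * ∑ z ∈ Z, min (degInto R z) (degInto Q z) :=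
        Nat.add_le_add (Nat.mul_le_mul_left _ h1) (Nat.mul_le_mul_left _ h2)
    _ = _ := by ring

-- A boundary edge of the filled set joins `R` to `Q`, or a point of `Z` to its minority side, or
-- two points of `Z` assigned differently.
open Classical in
theorem cubeBoundary_fill_le_add (h : SparsePartition D R Q Z) :
    cubeBoundary (fill R Q Z) ≤ cutEdges R Q + ∑ z ∈ Z, min (degInto R z) (degInto Q z) +
      ∑ z, ∑ i, if z ∈ Z ∧ flip z i ∈ Z ∧ degInto Q z < degInto R z ∧
        degInto R (flip z i) ≤ degInto Q (flip z i) then 1 else 0 := by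
  have hmin : (∑ z, ∑ i, ((if flip z i ∈ R ∧ z ∈ Z ∧ degInto R z ≤ degInto Q z then 1 else 0) +
      if z ∈ Z ∧ flip z i ∈ Q ∧ degInto Q z < degInto R z then 1 else 0)) ≤
      ∑ z ∈ Z, min (degInto R z) (degInto Q z) := by
    rw [sum_mem_eq_sum_ite Z]
    refine Finset.sum_le_sum fun z _ => ?_
    by_cases hz : z ∈ Z
    · rcases le_or_gt (degInto R z) (degInto Q z) with hle | hlt
      · simp only [hz, hle, hle.not_gt, and_true, and_false, if_true, if_false, add_zero,
          min_eq_left]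
        exact le_rfl
      · simp only [hz, hlt, hlt.not_ge, true_and, and_true, and_false, if_true, if_false, zero_add,
          min_eq_right hlt.le]
        exact le_rfl
    · simp [hz]
  have hflip : (∑ z, ∑ i, if flip z i ∈ R ∧ z ∈ Z ∧ degInto R z ≤ degInto Q z then 1 else 0) =
      ∑ x, ∑ i, if x ∈ R ∧ flip x i ∈ Z ∧ degInto R (flip x i) ≤ degInto Q (flip x i)
        then 1 else 0 := by
    rw [← sum_flip]
    simp only [flip_flip]
  simp only [Finset.sum_add_distrib] at hmin
  rw [hflip] at hmin
  refine le_trans ?_ (Nat.add_le_add_right (Nat.add_le_add_left hmin _) _)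
  unfold cubeBoundary cutEdges
  simp only [← Finset.sum_add_distrib]
  refine Finset.sum_le_sum fun x _ => Finset.sum_le_sum fun i _ => ?_
  by_cases hx : x ∈ fill R Q Z ∧ flip x i ∉ fill R Q Z
  swap
  · rw [if_neg hx]; exact Nat.zero_le _
  rw [if_pos hx]
  simp only [mem_fill, not_or, not_and, not_lt] at hx
  obtain ⟨hx, hy1, hy2⟩ := hx
  rcases hx with hx | hx <;> rcases h.cover (flip x i) with hy | hy | hy
  · exact absurd hy hy1
  · simp only [hx, hy, true_and, if_true]; omega
  · simp [hx, hy, hy2 hy]; omega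
  · exact absurd hy hy1
  · simp [hx, hy]; omega
  · simp [hx, hy, hy2 hy]

theorem cubeBoundary_fill_le (h : SparsePartition D R Q Z) :
    cubeBoundary (fill R Q Z) ≤ 2 * cutEdges R Q := by
  classical
  have h1 := h.cubeBoundary_fill_le_add
  have h2 := h.mul_sum_indicator_le
  have h3 := h.mul_sum_min_deg_le
  rcases Nat.eq_zero_or_pos k with hk | hk
  · subst hk
    simp [cubeBoundary]
  set S1 := ∑ z ∈ Z, min (degInto R z) (degInto Q z)
  set S2 := ∑ z, ∑ i, if z ∈ Z ∧ flip z i ∈ Z ∧ degInto Q z < degInto R z ∧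
        degInto R (flip z i) ≤ degInto Q (flip z i) then 1 else 0
  -- In units of `cutEdges R Q`, `S1` is at most 4/17 and `S2` at most 1/2 + 4/102, so the total
  -- stays below 2.
  have h4 : D * cutEdges R Q * 20 ≤ k * cutEdges R Q := by
    have := Nat.mul_le_mul_right (cutEdges R Q) h.le_dim
    linarith
  have h5 : 17 * S1 ≤ 4 * cutEdges R Q := by
    apply Nat.le_of_mul_le_mul_left _ hk
    linarith
  have h6 : 6 * S2 ≤ 3 * cutEdges R Q + S1 := by
    apply Nat.le_of_mul_le_mul_left _ hk
    linarith
  omega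

/-- Edge isoperimetry in the cube after the sparse set `Z` has been removed. -/
theorem card_mul_log_le (h : SparsePartition D R Q Z) :
    (R.card : ℝ) * (k * Real.log 2 - Real.log (fill R Q Z).card) ≤
      2 * cutEdges R Q * Real.log 2 := by
  have h1 := mul_log_le_cubeBoundary (fill R Q Z)
  have h2 : (cubeBoundary (fill R Q Z) : ℝ) ≤ 2 * cutEdges R Q := by
    exact_mod_cast h.cubeBoundary_fill_le
  have h3 : (R.card : ℝ) ≤ (fill R Q Z).card := by
    classical
    exact_mod_cast Finset.card_le_card (fun x hx => mem_fill.2 (Or.inl hx))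
  have h4 : 0 ≤ k * Real.log 2 - Real.log (fill R Q Z).card := by
    rw [← Real.log_pow, sub_nonneg]
    rcases Nat.eq_zero_or_pos (fill R Q Z).card with h0 | h0
    · rw [h0, Nat.cast_zero, Real.log_zero]
      exact Real.log_nonneg (one_le_pow₀ one_le_two)
    · apply Real.log_le_log (by exact_mod_cast h0)
      exact_mod_cast (Nat.le_add_right _ _).trans h.card_fill_add_card_le
  calc _ ≤ _ := mul_le_mul_of_nonneg_right h3 h4
    _ ≤ _ := h1
    _ ≤ _ := mul_le_mul_of_nonneg_right h2 (Real.log_pos one_lt_two).le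

end SparsePartition

end RandomPolytope

/-! ### Fibres over the first coordinates and the cut edges they produce. -/

namespace RandomPolytope

variable {n k : ℕ}

theorem hammingDist_lt_of_between {u v w : Fin n → Bool} (hw : ∀ j, u j = v j → w j = v j)
    (hne : w ≠ u) : hammingDist w v < hammingDist u v := by
  apply Finset.card_lt_card
  rw [Finset.ssubset_iff_of_subset]
  · obtain ⟨j, hj⟩ : ∃ j, w j ≠ u j := by
      by_contra! hcon
      exact hne (funext hcon)
    have huv : u j ≠ v j := fun h => hj ((hw j h).trans h.symm)
    refine ⟨j, by simpa using huv, ?_⟩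
    simpa using (by decide : ∀ a b c : Bool, a ≠ c → b ≠ a → b = c) (u j) (w j) (v j) huv hj
  · intro j
    simp only [Finset.mem_filter, Finset.mem_univ, true_and]
    exact fun h h' => h (hw j h')

/-- The projection of the cube to its first `k` coordinates. -/
def base (hk : k ≤ n) (z : Fin n → Bool) : Fin k → Bool := fun i => z (Fin.castLE hk i)

open Classical in
/-- The points of `U` over `x`. -/
noncomputable def fibre (hk : k ≤ n) (U : Finset (Fin n → Bool)) (x : Fin k → Bool) : Finset (Fin n → Bool) :=
  U.filter fun z => base hk z = x

theorem mem_fibre {hk : k ≤ n} {U : Finset (Fin n → Bool)} {x : Fin k → Bool} {z : Fin n → Bool} :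
    z ∈ fibre hk U x ↔ z ∈ U ∧ base hk z = x := by
  classical
  simp [fibre]

/-- Take `u` nearest to `v`. A point violating uniqueness agrees with `u` in all base coordinates,
hence lies in the same fibre, and would be nearer to `v`. -/
theorem exists_cubeAdj_of_fibre_flip_nonempty (hk : k ≤ n) {U : Finset (Fin n → Bool)}
    {v : Fin n → Bool} {i : Fin k} (hne : (fibre hk U (flip (base hk v) i)).Nonempty) :
    ∃ u ∈ U, base hk u = flip (base hk v) i ∧ CubeAdj U u v := by
  obtain ⟨u, hu, hmin⟩ := Finset.exists_min_image _ (fun u => hammingDist u v) hne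
  rw [mem_fibre] at hu
  have hcoord : ∀ j, u (Fin.castLE hk j) = flip (base hk v) i j := fun j => congrFun hu.2 j
  refine ⟨u, hu.1, hu.2, Fin.castLE hk i, ?_, ?_⟩
  · rw [hcoord, flip_apply_self, base]
    simp
  · intro w hw hspan hwi
    by_contra hwu
    refine (hmin w (mem_fibre.2 ⟨hw, ?_⟩)).not_gt (hammingDist_lt_of_between hspan hwu)
    rw [← hu.2]
    funext j
    rcases eq_or_ne j i with rfl | hj
    · exact hwi
    · have : u (Fin.castLE hk j) = v (Fin.castLE hk j) := by
        rw [hcoord, flip_apply_of_ne _ hj, base]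
      exact (hspan _ this).trans this.symm

/-- Take a pair across the cut at minimal distance. A violating `w` lies in the same fibre and could
replace `u` if it is in `A`, and `v` otherwise, giving a nearer pair. -/
theorem exists_cubeAdj_of_mixed (hk : k ≤ n) {U A : Finset (Fin n → Bool)}
    {x : Fin k → Bool} {u₀ v₀ : Fin n → Bool} (hu₀ : u₀ ∈ fibre hk A x) (hv₀ : v₀ ∈ fibre hk U x)
    (hv₀A : v₀ ∉ A) :
    ∃ u ∈ A, ∃ v ∈ U, v ∉ A ∧ base hk u = x ∧ base hk v = x ∧ CubeAdj U u v := by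
  classical
  obtain ⟨⟨u, v⟩, huv, hmin⟩ := Finset.exists_min_image
    (fibre hk A x ×ˢ (fibre hk U x).filter (· ∉ A)) (fun p => hammingDist p.1 p.2)
    ⟨(u₀, v₀), by simp [hu₀, hv₀, hv₀A]⟩
  simp only [Finset.mem_product, Finset.mem_filter, mem_fibre] at huv hmin
  obtain ⟨⟨huA, hux⟩, ⟨hvU, hvx⟩, hvA⟩ := huv
  have hne : u ≠ v := fun h => hvA (h ▸ huA)
  obtain ⟨i, hi⟩ : ∃ i, u i ≠ v i := by
    by_contra! hcon
    exact hne (funext hcon)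
  refine ⟨u, huA, v, hvU, hvA, hux, hvx, i, hi, ?_⟩
  intro w hw hspan hwi
  by_contra hwu
  have hwx : base hk w = x := by
    rw [← hux]
    funext j
    have h : u (Fin.castLE hk j) = v (Fin.castLE hk j) :=
      congrFun (hux.trans hvx.symm) j
    exact (hspan _ h).trans h.symm
  by_cases hwA : w ∈ A
  · exact (hmin (w, v) ⟨⟨hwA, hwx⟩, ⟨hvU, hvx⟩, hvA⟩).not_gt (hammingDist_lt_of_between hspan hwu)
  · refine (hmin (u, w) ⟨⟨huA, hux⟩, ⟨hw, hwx⟩, hwA⟩).not_gt ?_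
    have : hammingDist w u < hammingDist v u :=
      hammingDist_lt_of_between (fun j h => (hspan j h.symm).trans h)
        (fun h => hi (hwi.symm.trans (congrFun h i)))
    rwa [hammingDist_comm w u, hammingDist_comm v u] at this

open Classical in
/-- The pairs in `A × (U \ A)` that are certified to be adjacent on the polytope of `U`. -/
noncomputable def cutPairs (U A : Finset (Fin n → Bool)) : Finset ((Fin n → Bool) × (Fin n → Bool)) :=
  (A ×ˢ (U \ A)).filter fun p => CubeAdj U p.1 p.2 ∨ CubeAdj U p.2 p.1

theorem mem_cutPairs {U A : Finset (Fin n → Bool)} {u v : Fin n → Bool} :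
    (u, v) ∈ cutPairs U A ↔ (u ∈ A ∧ v ∈ U ∧ v ∉ A) ∧ (CubeAdj U u v ∨ CubeAdj U v u) := by
  classical
  simp [cutPairs]

open Classical in
/-- The base points with a nonempty fibre. -/
noncomputable def occupied (hk : k ≤ n) (U : Finset (Fin n → Bool)) : Finset (Fin k → Bool) :=
  Finset.univ.filter fun x => (fibre hk U x).Nonempty

open Classical in
/-- The base points whose fibre is nonempty and contained in `A`. -/
noncomputable def fullBase (hk : k ≤ n) (U A : Finset (Fin n → Bool)) : Finset (Fin k → Bool) :=
  Finset.univ.filter fun x => (fibre hk U x).Nonempty ∧ fibre hk U x ⊆ A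

open Classical in
/-- The base points whose fibre meets both `A` and its complement. -/
noncomputable def mixedBase (hk : k ≤ n) (U A : Finset (Fin n → Bool)) : Finset (Fin k → Bool) :=
  Finset.univ.filter fun x => (fibre hk A x).Nonempty ∧ ¬ fibre hk U x ⊆ A

theorem mem_occupied {hk : k ≤ n} {U : Finset (Fin n → Bool)} {x : Fin k → Bool} :
    x ∈ occupied hk U ↔ (fibre hk U x).Nonempty := by
  classical
  simp [occupied]

theorem mem_fullBase {hk : k ≤ n} {U A : Finset (Fin n → Bool)} {x : Fin k → Bool} :
    x ∈ fullBase hk U A ↔ (fibre hk U x).Nonempty ∧ fibre hk U x ⊆ A := by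
  classical
  simp [fullBase]

theorem mem_mixedBase {hk : k ≤ n} {U A : Finset (Fin n → Bool)} {x : Fin k → Bool} :
    x ∈ mixedBase hk U A ↔ (fibre hk A x).Nonempty ∧ ¬ fibre hk U x ⊆ A := by
  classical
  simp [mixedBase]

open Classical in
theorem cutEdges_eq_card (S T : Finset (Fin k → Bool)) :
    cutEdges S T =
      (Finset.univ.filter fun p : (Fin k → Bool) × Fin k => p.1 ∈ S ∧ flip p.1 p.2 ∈ T).card := by
  rw [cutEdges, Finset.card_filter, Fintype.sum_prod_type]

-- The base points of a cut pair determine the cube edge, and its orientation too, because only one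
-- endpoint lies in `S`.
open Classical in
theorem cutEdges_le_card_cutPairs (hk : k ≤ n) {U A : Finset (Fin n → Bool)}
    {S : Finset (Fin k → Bool)}
    (h : ∀ x i, x ∈ S → flip x i ∈ occupied hk U \ S → ∃ u v, (u, v) ∈ cutPairs U A ∧
      (base hk u = x ∧ base hk v = flip x i ∨ base hk v = x ∧ base hk u = flip x i)) :
    cutEdges S (occupied hk U \ S) ≤ (cutPairs U A).card := by
  rw [cutEdges_eq_card]
  refine Finset.card_le_card_of_forall_subsingleton
    (fun (p : (Fin k → Bool) × Fin k) (q : (Fin n → Bool) × (Fin n → Bool)) =>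
      base hk q.1 = p.1 ∧ base hk q.2 = flip p.1 p.2 ∨
      base hk q.2 = p.1 ∧ base hk q.1 = flip p.1 p.2) ?_ ?_
  · rintro ⟨x, i⟩ hp
    simp only [Finset.mem_filter, Finset.mem_univ, true_and] at hp
    obtain ⟨u, v, huv, hb⟩ := h x i hp.1 hp.2
    exact ⟨(u, v), huv, hb⟩
  · rintro ⟨u, v⟩ - ⟨x, i⟩ ⟨hp, hxi⟩ ⟨y, j⟩ ⟨hq, hyj⟩
    simp only [Finset.mem_filter, Finset.mem_univ, true_and, Finset.mem_sdiff] at hp hq hxi hyj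
    rcases hxi with ⟨h1, h2⟩ | ⟨h1, h2⟩ <;> rcases hyj with ⟨h3, h4⟩ | ⟨h3, h4⟩
    · obtain rfl : x = y := h1.symm.trans h3
      rw [flip_right_injective x (h2.symm.trans h4)]
    · exact absurd hp.1 (by rw [← h1, h4]; exact hq.2.2)
    · exact absurd hp.1 (by rw [← h1, h4]; exact hq.2.2)
    · obtain rfl : x = y := h1.symm.trans h3
      rw [flip_right_injective x (h2.symm.trans h4)]

open Classical in
theorem cutEdges_fullBase_le (hk : k ≤ n) {U A : Finset (Fin n → Bool)} :
    cutEdges (fullBase hk U A) (occupied hk U \ fullBase hk U A) ≤ (cutPairs U A).card := by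
  refine cutEdges_le_card_cutPairs hk fun x i hx hy => ?_
  rw [Finset.mem_sdiff, mem_occupied, mem_fullBase] at hy
  rw [mem_fullBase] at hx
  obtain ⟨v, hv, hvA⟩ := Finset.not_subset.1 fun h => hy.2 ⟨hy.1, h⟩
  rw [mem_fibre] at hv
  have hflip : flip (base hk v) i = x := by rw [hv.2, flip_flip]
  obtain ⟨u, hu, hux, hadj⟩ := exists_cubeAdj_of_fibre_flip_nonempty hk
    (v := v) (i := i) (by rw [hflip]; exact hx.1)
  rw [hflip] at hux
  exact ⟨u, v, mem_cutPairs.2 ⟨⟨hx.2 (mem_fibre.2 ⟨hu, hux⟩), hv.1, hvA⟩, Or.inl hadj⟩,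
    Or.inl ⟨hux, hv.2⟩⟩

-- A mixed fibre offers points on both sides. A nonempty neighbouring fibre that is not mixed lies
-- entirely on one side, so starting from the point on the other side makes the nearest-point edge
-- cross the cut.
open Classical in
theorem cutEdges_mixedBase_le (hk : k ≤ n) {U A : Finset (Fin n → Bool)} :
    cutEdges (mixedBase hk U A) (occupied hk U \ mixedBase hk U A) ≤ (cutPairs U A).card := by
  refine cutEdges_le_card_cutPairs hk fun x i hx hy => ?_
  rw [Finset.mem_sdiff, mem_occupied, mem_mixedBase] at hy
  rw [mem_mixedBase] at hx
  obtain ⟨⟨u, hu⟩, hnot⟩ := hx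
  obtain ⟨v, hv, hvA⟩ := Finset.not_subset.1 hnot
  rw [mem_fibre] at hu hv
  by_cases hfull : fibre hk U (flip x i) ⊆ A
  · obtain ⟨w, hw, hwx, hadj⟩ := exists_cubeAdj_of_fibre_flip_nonempty hk
      (v := v) (i := i) (by rw [hv.2]; exact hy.1)
    rw [hv.2] at hwx
    exact ⟨w, v, mem_cutPairs.2 ⟨⟨hfull (mem_fibre.2 ⟨hw, hwx⟩), hv.1, hvA⟩, Or.inl hadj⟩,
      Or.inr ⟨hv.2, hwx⟩⟩
  · obtain ⟨w, hw, hwx, hadj⟩ := exists_cubeAdj_of_fibre_flip_nonempty hk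
      (v := u) (i := i) (by rw [hu.2]; exact hy.1)
    rw [hu.2] at hwx
    have hwA : w ∉ A := fun h => hy.2 ⟨⟨w, mem_fibre.2 ⟨h, hwx⟩⟩, hfull⟩
    exact ⟨u, w, mem_cutPairs.2 ⟨⟨hu.1, hw, hwA⟩, Or.inr hadj⟩, Or.inl ⟨hu.2, hwx⟩⟩

theorem card_mixedBase_le (hk : k ≤ n) {U A : Finset (Fin n → Bool)} :
    (mixedBase hk U A).card ≤ (cutPairs U A).card := by
  classical
  refine Finset.card_le_card_of_forall_subsingleton
    (fun (x : Fin k → Bool) (q : (Fin n → Bool) × (Fin n → Bool)) => base hk q.1 = x) ?_ ?_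
  · intro x hx
    obtain ⟨⟨u₀, hu₀⟩, hnot⟩ := mem_mixedBase.1 hx
    obtain ⟨v₀, hv₀, hv₀A⟩ := Finset.not_subset.1 hnot
    obtain ⟨u, hu, v, hv, hvA, hux, -, hadj⟩ := exists_cubeAdj_of_mixed hk hu₀ hv₀ hv₀A
    exact ⟨(u, v), mem_cutPairs.2 ⟨⟨hu, hv, hvA⟩, Or.inl hadj⟩, hux⟩
  · rintro q - x ⟨-, hx⟩ y ⟨-, hy⟩
    exact hx.symm.trans hy

theorem card_eq_sum_card_fibre (hk : k ≤ n) (U : Finset (Fin n → Bool)) :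
    U.card = ∑ x, (fibre hk U x).card := by
  classical
  exact Finset.card_eq_sum_card_fiberwise (f := base hk) (t := Finset.univ) (by simp)

theorem card_le_sum_fullBase_add_sum_mixedBase (hk : k ≤ n) {U A : Finset (Fin n → Bool)}
    (hA : A ⊆ U) :
    A.card ≤ ∑ x ∈ fullBase hk U A, (fibre hk U x).card +
      ∑ x ∈ mixedBase hk U A, (fibre hk U x).card := by
  classical
  rw [card_eq_sum_card_fibre hk A, sum_mem_eq_sum_ite (fullBase hk U A),
    sum_mem_eq_sum_ite (mixedBase hk U A), ← Finset.sum_add_distrib]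
  refine Finset.sum_le_sum fun x _ => ?_
  have hsub : fibre hk A x ⊆ fibre hk U x := fun z hz =>
    mem_fibre.2 ⟨hA (mem_fibre.1 hz).1, (mem_fibre.1 hz).2⟩
  rcases (fibre hk A x).eq_empty_or_nonempty with h | h
  · simp [h]
  · by_cases hf : fibre hk U x ⊆ A
    · rw [if_pos (mem_fullBase.2 ⟨h.mono hsub, hf⟩)]
      exact (Finset.card_le_card hsub).trans (Nat.le_add_right _ _)
    · rw [if_pos (mem_mixedBase.2 ⟨h, hf⟩)]
      exact (Finset.card_le_card hsub).trans (Nat.le_add_left _ _)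

theorem sum_fullBase_le (hk : k ≤ n) {U A : Finset (Fin n → Bool)} :
    ∑ x ∈ fullBase hk U A, (fibre hk U x).card ≤ A.card := by
  classical
  rw [card_eq_sum_card_fibre hk A]
  calc _ ≤ ∑ x ∈ fullBase hk U A, (fibre hk A x).card := by
        refine Finset.sum_le_sum fun x hx => Finset.card_le_card fun z hz => ?_
        exact mem_fibre.2 ⟨(mem_fullBase.1 hx).2 hz, (mem_fibre.1 hz).2⟩
    _ ≤ _ := Finset.sum_le_sum_of_subset (Finset.subset_univ _)

theorem card_mixedBase_le_card (hk : k ≤ n) {U A : Finset (Fin n → Bool)} :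
    (mixedBase hk U A).card ≤ A.card := by
  classical
  refine (Finset.card_le_card (t := A.image (base hk)) fun x hx => ?_).trans Finset.card_image_le
  obtain ⟨z, hz⟩ := (mem_mixedBase.1 hx).1
  exact Finset.mem_image.2 ⟨z, mem_fibre.1 hz⟩

theorem card_fullBase_le_card (hk : k ≤ n) {U A : Finset (Fin n → Bool)} :
    (fullBase hk U A).card ≤ A.card := by
  refine le_trans ?_ (sum_fullBase_le hk (U := U))
  rw [Finset.card_eq_sum_ones]
  exact Finset.sum_le_sum fun x hx => (mem_fullBase.1 hx).1.card_pos

end RandomPolytope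

/-! ### Typical fibres imply expansion. -/

namespace RandomPolytope

variable {n k : ℕ}

/-- Jensen's inequality for the logarithm, proved by the tangent bound `log y ≤ y - 1` at `y = q ^ N
x * S.card / B`. -/
theorem sum_mul_log_le_of_sum_pow_le {α : Type*} {S : Finset α} {N : α → ℕ} {B q : ℝ} (hq : 0 < q)
    (hS : S.Nonempty) (hB : 0 < B) (h : ∑ x ∈ S, q ^ N x ≤ B) :
    (∑ x ∈ S, (N x : ℝ)) * Real.log q ≤ S.card * (Real.log B - Real.log S.card) := by
  have hc : (0 : ℝ) < S.card := by exact_mod_cast hS.card_pos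
  have hterm : ∀ x ∈ S, (N x : ℝ) * Real.log q ≤
      (Real.log B - Real.log S.card - 1) + q ^ N x * (S.card / B) := by
    intro x _
    have h1 := Real.log_le_sub_one_of_pos (x := q ^ N x * (S.card / B)) (by positivity)
    rw [Real.log_mul (by positivity) (by positivity), Real.log_pow,
      Real.log_div hc.ne' hB.ne'] at h1
    linarith
  rw [Finset.sum_mul]
  calc _ ≤ ∑ x ∈ S, ((Real.log B - Real.log S.card - 1) + q ^ N x * (S.card / B)) :=
        Finset.sum_le_sum hterm
    _ = S.card * (Real.log B - Real.log S.card - 1) + (∑ x ∈ S, q ^ N x) * (S.card / B) := by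
        rw [Finset.sum_add_distrib, Finset.sum_const, nsmul_eq_mul, Finset.sum_mul]
    _ ≤ S.card * (Real.log B - Real.log S.card - 1) + B * (S.card / B) := by gcongr
    _ = _ := by field_simp; ring

theorem sq_sum_le_of_sum_pow_le {α : Type*} {S : Finset α} {N : α → ℕ} {B : ℝ}
    (h : ∑ x ∈ S, (256 : ℝ) ^ N x ≤ B) : (∑ x ∈ S, (N x : ℝ)) ^ 2 ≤ S.card * B := by
  refine sq_sum_le_card_mul_sum_sq.trans (mul_le_mul_of_nonneg_left (le_trans ?_ h) (by positivity))
  refine Finset.sum_le_sum fun x _ => ?_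
  have h1 : (N x : ℝ) ≤ 2 ^ N x := by exact_mod_cast Nat.lt_two_pow_self.le
  calc (N x : ℝ) ^ 2 ≤ (2 ^ N x) ^ 2 := by gcongr
    _ = 4 ^ N x := by rw [← pow_mul, mul_comm, pow_mul]; norm_num
    _ ≤ 256 ^ N x := by gcongr; norm_num

/-- The fibres of `U` over the first `k` coordinates behave typically: no base point has many
empty neighbouring fibres, and the fibre sizes have an exponential moment at most `K`. -/
structure TypicalFibres (hk : k ≤ n) (U : Finset (Fin n → Bool)) (K : ℝ) : Prop where
  deg_le : ∀ x, 20 * degInto (Finset.univ \ occupied hk U) x ≤ k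
  sum_le : ∑ x, (256 : ℝ) ^ (fibre hk U x).card ≤ K * 2 ^ k

namespace TypicalFibres

variable {hk : k ≤ n} {U : Finset (Fin n → Bool)} {K : ℝ}

theorem sum_mem_le (h : TypicalFibres hk U K) (S : Finset (Fin k → Bool)) :
    ∑ x ∈ S, (256 : ℝ) ^ (fibre hk U x).card ≤ K * 2 ^ k :=
  le_trans (Finset.sum_le_univ_sum_of_nonneg fun _ => by positivity) h.sum_le

open Classical in
theorem sparsePartition (h : TypicalFibres hk U K) {S : Finset (Fin k → Bool)}
    (hS : S ⊆ occupied hk U) :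
    SparsePartition (k / 20) S (occupied hk U \ S) (Finset.univ \ occupied hk U) where
  cover x := by
    by_cases h1 : x ∈ S <;> by_cases h2 : x ∈ occupied hk U <;> simp [h1, h2]
  notMem_RQ x hx := by simp [hx]
  notMem_RZ x hx := by simp [hS hx]
  notMem_QZ x hx := by simp [(Finset.mem_sdiff.1 hx).1]
  deg_le x := by
    rw [Nat.le_div_iff_mul_le (by norm_num), mul_comm]
    convert h.deg_le x
  le_dim := Nat.mul_div_le k 20

theorem card_le (h : TypicalFibres hk U K) : (U.card : ℝ) ≤ K * 2 ^ k := by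
  refine le_trans ?_ h.sum_le
  rw [card_eq_sum_card_fibre hk U, Nat.cast_sum]
  refine Finset.sum_le_sum fun x _ => ?_
  calc ((fibre hk U x).card : ℝ) ≤ 2 ^ (fibre hk U x).card := by
        exact_mod_cast Nat.lt_two_pow_self.le
    _ ≤ _ := by gcongr; norm_num

/-- Averaging the degree bound over the cube shows that at most one base point in 20 is empty, and
each occupied one contributes a point of `U`. -/
theorem two_pow_le_two_mul_card (h : TypicalFibres hk U K) (hk0 : 0 < k) : 2 ^ k ≤ 2 * U.card := by
  classical
  set Z := Finset.univ \ occupied hk U with hZ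
  have h1 : k * (20 * Z.card) ≤ k * 2 ^ k := by
    calc k * (20 * Z.card) = 20 * cutEdges Z Finset.univ := by
          rw [cutEdges_eq_sum]
          simp only [degInto, Finset.mem_univ, if_true, Finset.sum_const, Finset.card_univ,
            Fintype.card_fin, smul_eq_mul]
          ring
      _ = ∑ x : Fin k → Bool, 20 * degInto Z x := by
          rw [cutEdges_comm, cutEdges_eq_sum, Finset.mul_sum]
      _ ≤ ∑ x : Fin k → Bool, k := Finset.sum_le_sum fun x _ => by convert h.deg_le x
      _ = k * 2 ^ k := by simp [mul_comm]
  have h2 := Nat.le_of_mul_le_mul_left h1 hk0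
  have h3 : Z.card = 2 ^ k - (occupied hk U).card := by
    rw [hZ, Finset.card_sdiff_of_subset (Finset.subset_univ _)]
    simp
  have h4 : (occupied hk U).card ≤ U.card := by
    rw [card_eq_sum_card_fibre hk U]
    calc (occupied hk U).card = ∑ x ∈ occupied hk U, 1 := Finset.card_eq_sum_ones _
      _ ≤ ∑ x ∈ occupied hk U, (fibre hk U x).card :=
        Finset.sum_le_sum fun x hx => (mem_occupied.1 hx).card_pos
      _ ≤ _ := Finset.sum_le_sum_of_subset (Finset.subset_univ _)
  omega

-- Put `L = log (2 ^ k / S.card)`. Since `256 = 2 ^ 8`, Jensen bounds the left side times `log 2` by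
-- `S.card * (log K + L) / 4`. Isoperimetry, with the filled set at most twice as large as `S`,
-- bounds the right side times `log 2` below by `S.card * (L - log 2) / 2`. The comparison needs
-- exactly `L ≥ log (4 * K)`. The factor 2 allows full and mixed base points to be treated
-- separately.
open Classical in
theorem two_mul_sum_le_cutEdges (h : TypicalFibres hk U K) (hK : 1 ≤ K) {S : Finset (Fin k → Bool)}
    (hS : S ⊆ occupied hk U) (hsmall : 4 * K * S.card ≤ 2 ^ k) :
    2 * ∑ x ∈ S, (fibre hk U x).card ≤ cutEdges S (occupied hk U \ S) := by
  rcases S.eq_empty_or_nonempty with rfl | hne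
  · simp
  have hc : (0 : ℝ) < S.card := by exact_mod_cast hne.card_pos
  have hK0 : 0 < K := by linarith
  have hL : 0 < Real.log 2 := Real.log_pos one_lt_two
  have h1 := sum_mul_log_le_of_sum_pow_le (by norm_num : (0 : ℝ) < 256) hne (by positivity)
    (h.sum_mem_le S)
  have h2 := (h.sparsePartition hS).card_mul_log_le
  have h3 := (h.sparsePartition hS).card_fill_le
  set F := SparsePartition.fill S (occupied hk U \ S) (Finset.univ \ occupied hk U)
  have hF : S.card ≤ F.card :=
    Finset.card_le_card fun x hx => SparsePartition.mem_fill.2 (Or.inl hx)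
  have h4 : Real.log F.card ≤ Real.log 2 + Real.log S.card := by
    rw [← Real.log_mul two_ne_zero hc.ne']
    apply Real.log_le_log
    · exact_mod_cast hne.card_pos.trans_le hF
    · exact_mod_cast h3
  have h5 : 2 * Real.log 2 + Real.log K + Real.log S.card ≤ k * Real.log 2 := by
    have := Real.log_le_log (by positivity) hsmall
    rw [Real.log_mul (by positivity) hc.ne', Real.log_mul (by norm_num) hK0.ne',
      Real.log_pow, show (4 : ℝ) = 2 ^ 2 by norm_num, Real.log_pow] at this
    exact_mod_cast this
  have e1 : Real.log (256 : ℝ) = 8 * Real.log 2 := by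
    rw [show (256 : ℝ) = 2 ^ 8 by norm_num, Real.log_pow]; norm_num
  rw [e1, Real.log_mul hK0.ne' (by positivity), Real.log_pow] at h1
  have h6 : (2 * ∑ x ∈ S, ((fibre hk U x).card : ℝ)) * Real.log 2 ≤
      cutEdges S (occupied hk U \ S) * Real.log 2 := by
    have h7 : (S.card : ℝ) * (Real.log K + k * Real.log 2 - Real.log S.card) ≤
        S.card * (2 * (k * Real.log 2 - Real.log F.card)) := by
      refine mul_le_mul_of_nonneg_left ?_ hc.le
      linarith
    linarith
  have h8 := le_of_mul_le_mul_right h6 hL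
  exact_mod_cast h8

open Classical in
theorem card_le_cutEdges_of_card_le (h : TypicalFibres hk U K) (hK : 1 ≤ K)
    {S : Finset (Fin k → Bool)} (hS : S ⊆ occupied hk U)
    (hlarge : 2 ^ k ≤ 16 * K * (occupied hk U \ S).card) :
    (S.card : ℝ) ≤ 32 * K * cutEdges S (occupied hk U \ S) := by
  have hK0 : 0 < K := by linarith
  rcases S.eq_empty_or_nonempty with rfl | hne
  · simp; positivity
  have h2 := (h.sparsePartition hS).card_mul_log_le
  have h3 := (h.sparsePartition hS).card_fill_add_card_le
  set F := SparsePartition.fill S (occupied hk U \ S) (Finset.univ \ occupied hk U)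
  have hF0 : (0 : ℝ) < F.card := by
    exact_mod_cast hne.card_pos.trans_le
      (Finset.card_le_card fun x hx => SparsePartition.mem_fill.2 (Or.inl hx))
  -- The filled set is disjoint from the remaining occupied points, so it misses a constant
  -- proportion of the cube and the logarithmic gain is at least `1 / (16 * K)`.
  have h4 : (F.card : ℝ) / 2 ^ k ≤ 1 - 1 / (16 * K) := by
    have h5 : (F.card : ℝ) + (occupied hk U \ S).card ≤ 2 ^ k := by exact_mod_cast h3
    have h6 : (2 : ℝ) ^ k / (16 * K) ≤ (occupied hk U \ S).card := by
      rw [div_le_iff₀ (by positivity)]; linarith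
    rw [div_le_iff₀ (by positivity)]
    calc (F.card : ℝ) ≤ 2 ^ k - 2 ^ k / (16 * K) := by linarith
      _ = _ := by ring
  have h5 : 1 / (16 * K) ≤ k * Real.log 2 - Real.log F.card := by
    have := Real.log_le_sub_one_of_pos (x := F.card / 2 ^ k) (by positivity)
    rw [Real.log_div hF0.ne' (by positivity), Real.log_pow] at this
    linarith
  have h6 : (S.card : ℝ) * (1 / (16 * K)) ≤ 2 * cutEdges S (occupied hk U \ S) := by
    calc _ ≤ _ := mul_le_mul_of_nonneg_left h5 (by positivity)
      _ ≤ _ := h2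
      _ ≤ 2 * cutEdges S (occupied hk U \ S) * 1 := by
        gcongr
        linarith [Real.log_two_lt_d9]
      _ = _ := by ring
  rw [mul_one_div, div_le_iff₀ (by positivity)] at h6
  linarith

theorem fullBase_subset_occupied {A : Finset (Fin n → Bool)} :
    fullBase hk U A ⊆ occupied hk U := fun _ hx => mem_occupied.2 (mem_fullBase.1 hx).1

theorem mixedBase_subset_occupied {A : Finset (Fin n → Bool)} (hA : A ⊆ U) :
    mixedBase hk U A ⊆ occupied hk U := by
  intro x hx
  obtain ⟨z, hz⟩ := (mem_mixedBase.1 hx).1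
  exact mem_occupied.2 ⟨z, mem_fibre.2 ⟨hA (mem_fibre.1 hz).1, (mem_fibre.1 hz).2⟩⟩

theorem card_le_card_cutPairs_of_small (h : TypicalFibres hk U K) (hK : 1 ≤ K)
    {A : Finset (Fin n → Bool)} (hA : A ⊆ U) (hR : 4 * K * (fullBase hk U A).card ≤ 2 ^ k)
    (hM : 4 * K * (mixedBase hk U A).card ≤ 2 ^ k) : A.card ≤ (cutPairs U A).card := by
  classical
  have h1 := h.two_mul_sum_le_cutEdges hK fullBase_subset_occupied hR
  have h2 := h.two_mul_sum_le_cutEdges hK (mixedBase_subset_occupied hA) hM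
  have h3 := card_le_sum_fullBase_add_sum_mixedBase hk hA
  have h4 := cutEdges_fullBase_le hk (U := U) (A := A)
  have h5 := cutEdges_mixedBase_le hk (U := U) (A := A)
  omega

theorem card_le_card_cutPairs (h : TypicalFibres hk U K) (hK : 1 ≤ K)
    {A : Finset (Fin n → Bool)} (hA : A ⊆ U) (hAU : 4 * K ^ 2 * A.card ≤ U.card) :
    A.card ≤ (cutPairs U A).card := by
  have hK0 : 0 < K := by linarith
  have h1 : 4 * K * A.card ≤ 2 ^ k := by
    have := hAU.trans h.card_le
    apply le_of_mul_le_mul_left _ hK0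
    linarith
  refine h.card_le_card_cutPairs_of_small hK hA (le_trans ?_ h1) (le_trans ?_ h1)
  · gcongr
    exact_mod_cast card_fullBase_le_card hk
  · gcongr
    exact_mod_cast card_mixedBase_le_card hk

/-- If many base points are mixed, each has its own cut pair. If full and mixed points are both few,
the bound for small sets applies. Otherwise many points are full, and isoperimetry applies once the
other occupied points are shown to be numerous as well. -/
theorem card_le_mul_card_cutPairs (h : TypicalFibres hk U K) (hK : 1 ≤ K) (hk0 : 0 < k)
    {A : Finset (Fin n → Bool)} (hA : A ⊆ U) (hAU : 2 * A.card ≤ U.card) :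
    (A.card : ℝ) ≤ 128 * K ^ 3 * (cutPairs U A).card := by
  classical
  have hK0 : 0 < K := by linarith
  have hAK : (A.card : ℝ) ≤ K * 2 ^ k :=
    le_trans (by exact_mod_cast Finset.card_le_card hA) h.card_le
  have hK2 : 1 ≤ K ^ 2 := one_le_pow₀ hK
  have hKK : K ^ 2 ≤ K ^ 3 := pow_le_pow_right₀ hK (by norm_num)
  have hcut : (0 : ℝ) ≤ (cutPairs U A).card := Nat.cast_nonneg _
  by_cases hM : 4 * K * (mixedBase hk U A).card ≤ 2 ^ k
  swap
  · have h1 : ((mixedBase hk U A).card : ℝ) ≤ (cutPairs U A).card := by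
      exact_mod_cast card_mixedBase_le hk
    calc (A.card : ℝ) ≤ K * (4 * K * (mixedBase hk U A).card) := by
          refine hAK.trans ?_
          gcongr
          exact (not_le.1 hM).le
      _ ≤ K * (4 * K * (cutPairs U A).card) := by gcongr
      _ = 4 * K ^ 2 * (cutPairs U A).card := by ring
      _ ≤ _ := by gcongr; linarith
  by_cases hR : 4 * K * (fullBase hk U A).card ≤ 2 ^ k
  · have h1 : (A.card : ℝ) ≤ (cutPairs U A).card := by
      exact_mod_cast h.card_le_card_cutPairs_of_small hK hA hR hM
    calc _ ≤ _ := h1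
      _ = 1 * ((cutPairs U A).card : ℝ) := (one_mul _).symm
      _ ≤ _ := by gcongr; linarith
  have h1 : U.card ≤ A.card + ∑ x ∈ occupied hk U \ fullBase hk U A, (fibre hk U x).card := by
    rw [card_eq_sum_card_fibre hk U]
    have h2 : ∑ x, (fibre hk U x).card = ∑ x ∈ occupied hk U, (fibre hk U x).card := by
      refine (Finset.sum_subset (Finset.subset_univ _) fun x _ hx => ?_).symm
      rw [mem_occupied, Finset.not_nonempty_iff_eq_empty] at hx
      simp [hx]
    rw [h2, ← Finset.sum_sdiff (fullBase_subset_occupied (hk := hk) (U := U) (A := A)), add_comm]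
    exact Nat.add_le_add_right (sum_fullBase_le hk) _
  have h2 := h.two_pow_le_two_mul_card hk0
  have h3 : (2 : ℝ) ^ k ≤
      4 * ∑ x ∈ occupied hk U \ fullBase hk U A, ((fibre hk U x).card : ℝ) := by
    have : 2 ^ k ≤ 4 * ∑ x ∈ occupied hk U \ fullBase hk U A, (fibre hk U x).card := by omega
    exact_mod_cast this
  -- The non-full fibres hold at least `2 ^ k / 4` points of `U`. By Cauchy–Schwarz and the moment
  -- bound, this mass cannot sit over few base points.
  have h4 := sq_sum_le_of_sum_pow_le (h.sum_mem_le (occupied hk U \ fullBase hk U A))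
  have h5 : (2 : ℝ) ^ k ≤ 16 * K * (occupied hk U \ fullBase hk U A).card := by
    have hp : (0 : ℝ) < 2 ^ k := by positivity
    apply le_of_mul_le_mul_left _ hp
    have := pow_le_pow_left₀ hp.le h3 2
    rw [mul_pow] at this
    linarith
  have h6 := h.card_le_cutEdges_of_card_le hK fullBase_subset_occupied h5
  have h7 : (cutEdges (fullBase hk U A) (occupied hk U \ fullBase hk U A) : ℝ) ≤
      (cutPairs U A).card := by
    exact_mod_cast cutEdges_fullBase_le hk
  calc (A.card : ℝ) ≤ K * (4 * K * (fullBase hk U A).card) := by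
        refine hAK.trans ?_
        gcongr
        exact (not_le.1 hR).le
    _ ≤ K * (4 * K * (32 * K * (cutPairs U A).card)) := by
        gcongr
        exact h6.trans (by gcongr)
    _ = _ := by ring

end TypicalFibres

end RandomPolytope

/-! ### The random set has typical fibres. -/

namespace RandomPolytope

section Bernoulli

variable {α : Type*} [Fintype α]

open Classical in
/-- The expectation of `F` at a random subset of `α` containing each point independently with
probability `p`. -/
noncomputable def bernoulliMean (p : ℝ) (F : Finset α → ℝ) : ℝ :=
  ∑ s : Finset α, p ^ s.card * (1 - p) ^ (Fintype.card α - s.card) * F s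

open Classical in
theorem bernoulliMean_prod (p : ℝ) (f : α → ℝ) :
    bernoulliMean p (fun s => ∏ z ∈ s, f z) = ∏ z, (p * f z + (1 - p)) := by
  rw [Finset.prod_add, Finset.powerset_univ]
  refine Finset.sum_congr rfl fun s _ => ?_
  rw [Finset.prod_mul_distrib, Finset.prod_const, Finset.prod_const,
    Finset.card_sdiff_of_subset (Finset.subset_univ _), Finset.card_univ]
  ring

theorem bernoulliMean_prod_le {p : ℝ} (h0 : 0 ≤ p) (h1 : p ≤ 1) {f : α → ℝ} (hf : ∀ z, 0 ≤ f z) :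
    bernoulliMean p (fun s => ∏ z ∈ s, f z) ≤ Real.exp (p * ∑ z, (f z - 1)) := by
  rw [bernoulliMean_prod, Finset.mul_sum, Real.exp_sum]
  refine Finset.prod_le_prod (fun z _ => ?_) fun z _ => ?_
  · have := mul_nonneg h0 (hf z)
    linarith
  · have := Real.add_one_le_exp (p * (f z - 1))
    linarith

theorem bernoulliMean_one (p : ℝ) : bernoulliMean p (fun _ : Finset α => 1) = 1 := by
  classical
  simpa using bernoulliMean_prod (α := α) p (fun _ => 1)

theorem bernoulliMean_sum {ι : Type*} (p : ℝ) (t : Finset ι) (F : ι → Finset α → ℝ) :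
    bernoulliMean p (fun s => ∑ i ∈ t, F i s) = ∑ i ∈ t, bernoulliMean p (F i) := by
  classical
  simp only [bernoulliMean, Finset.mul_sum]
  exact Finset.sum_comm

theorem bernoulliMean_const_mul (p c : ℝ) (F : Finset α → ℝ) :
    bernoulliMean p (fun s => c * F s) = c * bernoulliMean p F := by
  classical
  simp only [bernoulliMean, Finset.mul_sum]
  exact Finset.sum_congr rfl fun s _ => by ring

theorem bernoulliMean_add (p : ℝ) (F G : Finset α → ℝ) :
    bernoulliMean p (fun s => F s + G s) = bernoulliMean p F + bernoulliMean p G := by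
  classical
  simp only [bernoulliMean, mul_add, Finset.sum_add_distrib]

-- Markov's inequality in the form used below: any nonnegative `F` that is at least 1 on the event
-- bounds its probability by a finite sum.
open Classical in
theorem setBernoulli_real_le_bernoulliMean (p : unitInterval) (S : Set (Set α)) {F : Finset α → ℝ}
    (h0 : ∀ s, 0 ≤ F s) (h1 : ∀ s : Finset α, (s : Set α) ∈ S → 1 ≤ F s) :
    (ProbabilityTheory.setBernoulli Set.univ p).real S ≤ bernoulliMean (p : ℝ) F := by
  have hp0 := p.2.1
  have hp1 := p.2.2
  have hsub : S ⊆ ⋃ s ∈ Finset.univ.filter (fun s : Finset α => (s : Set α) ∈ S), {(s : Set α)} := by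
    intro U hU
    simp only [Finset.mem_filter, Finset.mem_univ, true_and, Set.mem_iUnion,
      Set.mem_singleton_iff, exists_prop]
    exact ⟨U.toFinset, by simpa using hU, by simp⟩
  calc _ ≤ _ := MeasureTheory.measureReal_mono hsub (MeasureTheory.measure_ne_top _ _)
    _ ≤ _ := MeasureTheory.measureReal_biUnion_finset_le _ _
    _ ≤ bernoulliMean (p : ℝ) F := by
      rw [Finset.sum_filter]
      refine Finset.sum_le_sum fun s _ => ?_
      have hw : 0 ≤ (p : ℝ) ^ s.card * (1 - (p : ℝ)) ^ (Fintype.card α - s.card) :=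
        mul_nonneg (pow_nonneg hp0 _) (pow_nonneg (by linarith) _)
      split_ifs with hs
      · rw [ProbabilityTheory.setBernoulli_real_singleton p (Set.subset_univ _) Set.finite_univ,
          Set.ncard_coe_finset, ← Set.compl_eq_univ_sdiff, Set.ncard_compl, Set.ncard_coe_finset,
          Nat.card_eq_fintype_card]
        exact le_mul_of_one_le_right hw (h1 s hs)
      · exact mul_nonneg hw (h0 s)

end Bernoulli

variable {n k : ℕ}

theorem card_fibre_univ (hk : k ≤ n) (x : Fin k → Bool) :
    (fibre hk Finset.univ x).card = 2 ^ (n - k) := by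
  obtain ⟨d, rfl⟩ := Nat.exists_eq_add_of_le hk
  have h1 : (Finset.univ : Finset (Fin d → Bool)).card = 2 ^ (k + d - k) := by simp
  rw [← h1]
  refine (Finset.card_bij (fun w _ => Fin.append x w) ?_ ?_ ?_).symm
  · intro w _
    rw [mem_fibre]
    refine ⟨Finset.mem_univ _, funext fun i => ?_⟩
    exact Fin.append_left x w i
  · intro w _ w' _ h
    funext j
    simpa using congrFun h (Fin.natAdd k j)
  · intro z hz
    rw [mem_fibre] at hz
    refine ⟨fun j => z (Fin.natAdd k j), Finset.mem_univ _, ?_⟩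
    funext j
    refine Fin.addCases (fun i => ?_) (fun i => ?_) j
    · rw [Fin.append_left, ← hz.2]
      rfl
    · rw [Fin.append_right]

open Classical in
/-- The weight `q` on the points over `x` and `1` elsewhere. -/
noncomputable def fibreWeight (hk : k ≤ n) (q : ℝ) (x : Fin k → Bool) (z : Fin n → Bool) : ℝ :=
  if base hk z = x then q else 1

theorem prod_fibreWeight (hk : k ≤ n) (q : ℝ) (x : Fin k → Bool) (s : Finset (Fin n → Bool)) :
    ∏ z ∈ s, fibreWeight hk q x z = q ^ (fibre hk s x).card := by
  classical
  simp only [fibreWeight]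
  rw [← Finset.prod_filter, Finset.prod_const]
  congr

theorem sum_fibreWeight_sub_one (hk : k ≤ n) (q : ℝ) (x : Fin k → Bool) :
    ∑ z, (fibreWeight hk q x z - 1) = 2 ^ (n - k) * (q - 1) := by
  classical
  have h : ∀ z, fibreWeight hk q x z - 1 = if base hk z = x then q - 1 else 0 := by
    intro z
    unfold fibreWeight
    split_ifs <;> simp
  simp only [h, ← Finset.sum_filter, Finset.sum_const, nsmul_eq_mul]
  congr 1
  have := card_fibre_univ hk x
  rw [show Finset.univ.filter (fun z => base hk z = x) = fibre hk Finset.univ x by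
    ext z; simp [mem_fibre], this]
  push_cast
  rfl

theorem bernoulliMean_pow_card_fibre_le (hk : k ≤ n) {p q : ℝ} (h0 : 0 ≤ p) (h1 : p ≤ 1)
    (hq : 0 ≤ q) (x : Fin k → Bool) :
    bernoulliMean p (fun s => q ^ (fibre hk s x).card) ≤ Real.exp (p * 2 ^ (n - k) * (q - 1)) := by
  simp only [← prod_fibreWeight]
  refine (bernoulliMean_prod_le h0 h1 fun z => ?_).trans (le_of_eq ?_)
  · unfold fibreWeight
    split_ifs <;> linarith
  · rw [sum_fibreWeight_sub_one, mul_assoc]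

/-- Distinct fibres are disjoint, so their sizes are independent. -/
theorem bernoulliMean_pow_mul_pow (hk : k ≤ n) (p q : ℝ) {x y : Fin k → Bool} (hxy : x ≠ y) :
    bernoulliMean p (fun s => q ^ (fibre hk s x).card * q ^ (fibre hk s y).card) =
      bernoulliMean p (fun s => q ^ (fibre hk s x).card) *
      bernoulliMean p (fun s => q ^ (fibre hk s y).card) := by
  classical
  simp only [← prod_fibreWeight, ← Finset.prod_mul_distrib]
  rw [bernoulliMean_prod, bernoulliMean_prod, bernoulliMean_prod, ← Finset.prod_mul_distrib]
  refine Finset.prod_congr rfl fun z _ => ?_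
  unfold fibreWeight
  by_cases hx : base hk z = x
  · have hy : base hk z ≠ y := fun h => hxy (hx.symm.trans h)
    rw [if_pos hx, if_neg hy]; ring
  · rw [if_neg hx]; ring

/-- The variance of the exponential moment of the fibre sizes. -/
theorem bernoulliMean_sq_sub_le (hk : k ≤ n) {p q : ℝ} (h0 : 0 ≤ p) (h1 : p ≤ 1) :
    bernoulliMean p (fun s => (∑ x, q ^ (fibre hk s x).card -
        ∑ x, bernoulliMean p (fun s => q ^ (fibre hk s x).card)) ^ 2) ≤
      2 ^ k * Real.exp (p * 2 ^ (n - k) * (q ^ 2 - 1)) := by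
  classical
  set a : (Fin k → Bool) → ℝ := fun x => bernoulliMean p (fun s => q ^ (fibre hk s x).card) with ha
  have hexp : ∀ s : Finset (Fin n → Bool), (∑ x, q ^ (fibre hk s x).card - ∑ x, a x) ^ 2 =
      (∑ x, ∑ y, q ^ (fibre hk s x).card * q ^ (fibre hk s y).card) +
      ((-2 * ∑ x, a x) * (∑ x, q ^ (fibre hk s x).card) + (∑ x, a x) ^ 2 * 1) := by
    intro s
    rw [← Finset.sum_mul_sum]; ring
  simp only [hexp]
  rw [bernoulliMean_add, bernoulliMean_add, bernoulliMean_const_mul, bernoulliMean_const_mul,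
    bernoulliMean_one, bernoulliMean_sum, bernoulliMean_sum]
  have hterm : ∀ x, bernoulliMean p
      (fun s => ∑ y, q ^ (fibre hk s x).card * q ^ (fibre hk s y).card) ≤
      a x * ∑ y, a y + Real.exp (p * 2 ^ (n - k) * (q ^ 2 - 1)) := by
    intro x
    have hsq : bernoulliMean p (fun s => q ^ (fibre hk s x).card * q ^ (fibre hk s x).card) ≤
        Real.exp (p * 2 ^ (n - k) * (q ^ 2 - 1)) := by
      have := bernoulliMean_pow_card_fibre_le hk h0 h1 (sq_nonneg q) x
      simpa only [← pow_mul, ← pow_add, two_mul] using this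
    rw [bernoulliMean_sum, ← Finset.add_sum_erase _ _ (Finset.mem_univ x),
      ← Finset.add_sum_erase _ a (Finset.mem_univ x), mul_add, Finset.mul_sum]
    -- Off-diagonal covariances vanish, so only the second moments on the diagonal, which are
    -- moments with base `q ^ 2`, contribute.
    have hother : ∑ y ∈ Finset.univ.erase x,
        bernoulliMean p (fun s => q ^ (fibre hk s x).card * q ^ (fibre hk s y).card) =
        ∑ y ∈ Finset.univ.erase x, a x * a y :=
      Finset.sum_congr rfl fun y hy =>
        bernoulliMean_pow_mul_pow hk p q (Finset.ne_of_mem_erase hy).symm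
    rw [hother]
    nlinarith [mul_self_nonneg (a x)]
  have hsum := Finset.sum_le_sum fun x (_ : x ∈ Finset.univ) => hterm x
  rw [Finset.sum_add_distrib, ← Finset.sum_mul, Finset.sum_const, nsmul_eq_mul] at hsum
  simp only [Finset.card_univ, Fintype.card_fun, Fintype.card_bool, Fintype.card_fin,
    Nat.cast_pow, Nat.cast_ofNat] at hsum
  change _ + (_ * ∑ x, a x + _) ≤ _
  linarith

/-- The exponential moment of the fibre sizes is bounded with high probability. -/
theorem real_sum_pow_card_fibre_gt_le (hk : k ≤ n) (p : unitInterval) {q b : ℝ} (hq : 1 ≤ q)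
    (hb : (p : ℝ) * 2 ^ (n - k) ≤ b) :
    (randomCubeSubset n p).real {U | ∃ s : Finset (Fin n → Bool), (s : Set _) = U ∧
        2 * Real.exp (b * (q - 1)) * 2 ^ k < ∑ x, q ^ (fibre hk s x).card} ≤
      Real.exp (b * (q ^ 2 - 1)) / 2 ^ k := by
  have hp0 := p.2.1
  have hp1 := p.2.2
  have hb0 : 0 ≤ b := le_trans (by positivity) hb
  have hq2 : 1 ≤ q ^ 2 := one_le_pow₀ hq
  set m := ∑ x : Fin k → Bool, bernoulliMean (p : ℝ) (fun s => q ^ (fibre hk s x).card) with hm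
  have hmle : m ≤ 2 ^ k * Real.exp (b * (q - 1)) := by
    calc m ≤ ∑ x : Fin k → Bool, Real.exp (b * (q - 1)) := by
          refine Finset.sum_le_sum fun x _ =>
            (bernoulliMean_pow_card_fibre_le hk hp0 hp1 (by linarith) x).trans ?_
          gcongr
      _ = _ := by simp
  have hone : 1 ≤ Real.exp (b * (q - 1)) := Real.one_le_exp (mul_nonneg hb0 (by linarith))
  -- Chebyshev's inequality: the threshold is twice the upper bound for the mean, so exceeding it
  -- forces a deviation of at least `2 ^ k`.
  refine (setBernoulli_real_le_bernoulliMean p _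
    (F := fun s => (1 / (2 ^ k) ^ 2) * (∑ x, q ^ (fibre hk s x).card - m) ^ 2)
    (fun s => by positivity) ?_).trans ?_
  · rintro s ⟨s', hs', hlt⟩
    obtain rfl : s' = s := Finset.coe_injective hs'
    have h1 : (2 : ℝ) ^ k ≤ ∑ x, q ^ (fibre hk s' x).card - m := by
      have : (2 : ℝ) ^ k * 1 ≤ 2 ^ k * Real.exp (b * (q - 1)) := by gcongr
      linarith
    rw [one_div_mul_eq_div, le_div_iff₀ (by positivity), one_mul]
    gcongr
  · rw [bernoulliMean_const_mul]
    calc _ ≤ 1 / (2 ^ k) ^ 2 * (2 ^ k * Real.exp (p * 2 ^ (n - k) * (q ^ 2 - 1))) := by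
          gcongr
          exact bernoulliMean_sq_sub_le hk hp0 hp1
      _ ≤ 1 / (2 ^ k) ^ 2 * (2 ^ k * Real.exp (b * (q ^ 2 - 1))) := by
          gcongr
      _ = _ := by field_simp

open Classical in
/-- The indicator of the points lying over no neighbour of `x` in a direction of `T`. -/
noncomputable def avoidWeight (hk : k ≤ n) (x : Fin k → Bool) (T : Finset (Fin k))
    (z : Fin n → Bool) : ℝ :=
  if ∃ i ∈ T, base hk z = flip x i then 0 else 1

open Classical in
theorem sum_avoidWeight_sub_one (hk : k ≤ n) (x : Fin k → Bool) (T : Finset (Fin k)) :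
    ∑ z, (avoidWeight hk x T z - 1) = -(2 ^ (n - k) * T.card) := by
  have h : ∀ z, avoidWeight hk x T z - 1 = ∑ i ∈ T, if base hk z = flip x i then (-1 : ℝ) else 0 := by
    intro z
    unfold avoidWeight
    split_ifs with hz
    · obtain ⟨i, hi, hzi⟩ := hz
      rw [Finset.sum_eq_single i]
      · simp [hzi]
      · intro j _ hj
        rw [if_neg]
        exact fun h => hj (flip_right_injective x (h.symm.trans hzi))
      · exact fun h => absurd hi h
    · rw [Finset.sum_eq_zero]
      · simp
      · intro i hi
        rw [if_neg]
        exact fun h => hz ⟨i, hi, h⟩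
  simp only [h]
  rw [Finset.sum_comm]
  have h2 : ∀ i ∈ T, (∑ z, if base hk z = flip x i then (-1 : ℝ) else 0) = -2 ^ (n - k) := by
    intro i _
    rw [← Finset.sum_filter, Finset.sum_const, nsmul_eq_mul,
      show Finset.univ.filter (fun z => base hk z = flip x i) = fibre hk Finset.univ (flip x i) by
        ext z; simp [mem_fibre], card_fibre_univ]
    push_cast
    ring
  rw [Finset.sum_congr rfl h2, Finset.sum_const, nsmul_eq_mul]
  ring

open Classical in
/-- With high probability no base point has many empty neighbouring fibres. -/
theorem real_exists_lt_degInto_le (hk : k ≤ n) (p : unitInterval)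
    (hp : 60 ≤ (p : ℝ) * 2 ^ (n - k)) :
    (randomCubeSubset n p).real {U | ∃ s : Finset (Fin n → Bool), (s : Set _) = U ∧
        ∃ x, k < 20 * degInto (Finset.univ \ occupied hk s) x} ≤ 1 / 2 ^ k := by
  have hp0 := p.2.1
  have hp1 := p.2.2
  set 𝒯 : Finset (Finset (Fin k)) := Finset.univ.filter fun T => k < 20 * T.card with h𝒯
  have hnn : ∀ (x : Fin k → Bool) (T : Finset (Fin k)) (z : Fin n → Bool),
      0 ≤ avoidWeight hk x T z := by
    intro x T z
    unfold avoidWeight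
    split_ifs <;> norm_num
  -- A union bound over base points and sets `T` of more than `k / 20` directions. All fibres along
  -- `T` are empty with probability at most `exp (-60 * k / 20) ≤ 8 ^ (-k)`, and there are at most
  -- `4 ^ k` choices.
  refine (setBernoulli_real_le_bernoulliMean p _
    (F := fun s => ∑ x : Fin k → Bool, ∑ T ∈ 𝒯, ∏ z ∈ s, avoidWeight hk x T z)
    (fun s => Finset.sum_nonneg fun x _ => Finset.sum_nonneg fun T _ =>
      Finset.prod_nonneg fun z _ => hnn x T z) ?_).trans ?_
  · rintro s ⟨s', hs', x, hx⟩
    obtain rfl : s' = s := Finset.coe_injective hs'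
    set T : Finset (Fin k) :=
      Finset.univ.filter fun i => flip x i ∈ Finset.univ \ occupied hk s' with hT
    have hTc : T.card = degInto (Finset.univ \ occupied hk s') x := by
      rw [degInto, hT, Finset.card_filter]
    have hT𝒯 : T ∈ 𝒯 := by simpa [h𝒯, hTc] using hx
    have hprod : ∏ z ∈ s', avoidWeight hk x T z = 1 := by
      refine Finset.prod_eq_one fun z hz => ?_
      rw [avoidWeight, if_neg]
      rintro ⟨i, hi, hzi⟩
      simp only [hT, Finset.mem_filter, Finset.mem_univ, true_and, Finset.mem_sdiff,
        mem_occupied] at hi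
      exact hi ⟨z, mem_fibre.2 ⟨hz, hzi⟩⟩
    calc (1 : ℝ) = ∏ z ∈ s', avoidWeight hk x T z := hprod.symm
      _ ≤ ∑ T ∈ 𝒯, ∏ z ∈ s', avoidWeight hk x T z :=
        Finset.single_le_sum (f := fun T => ∏ z ∈ s', avoidWeight hk x T z)
          (fun T _ => Finset.prod_nonneg fun z _ => hnn x T z) hT𝒯
      _ ≤ _ := Finset.single_le_sum
        (f := fun x => ∑ T ∈ 𝒯, ∏ z ∈ s', avoidWeight hk x T z)
        (fun x _ => Finset.sum_nonneg fun T _ => Finset.prod_nonneg fun z _ => hnn x T z)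
        (Finset.mem_univ x)
  · have hterm : ∀ (x : Fin k → Bool), ∀ T ∈ 𝒯,
        bernoulliMean (p : ℝ) (fun s => ∏ z ∈ s, avoidWeight hk x T z) ≤ (1 / 8) ^ k := by
      intro x T hT
      refine (bernoulliMean_prod_le hp0 hp1 (hnn x T)).trans ?_
      rw [sum_avoidWeight_sub_one]
      have hTk : (k : ℝ) ≤ 20 * T.card := by
        exact_mod_cast (Finset.mem_filter.1 hT).2.le
      have h3 : 3 * (k : ℝ) ≤ p * 2 ^ (n - k) * T.card := by
        calc 3 * (k : ℝ) ≤ 60 * T.card := by linarith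
          _ ≤ _ := by gcongr
      have h8 : Real.exp (-3) ≤ 1 / 8 := by
        rw [Real.exp_neg, ← one_div]
        apply one_div_le_one_div_of_le (by norm_num)
        calc (8 : ℝ) = 2 ^ 3 := by norm_num
          _ ≤ Real.exp 1 ^ 3 := by
            gcongr
            linarith [Real.exp_one_gt_d9]
          _ = Real.exp 3 := by rw [← Real.exp_nat_mul]; norm_num
      calc Real.exp (p * -(2 ^ (n - k) * T.card)) ≤ Real.exp (k * (-3)) := by
            apply Real.exp_le_exp.2
            linarith
        _ = Real.exp (-3) ^ k := by rw [Real.exp_nat_mul]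
        _ ≤ _ := by gcongr
    have h𝒯c : (𝒯.card : ℝ) ≤ 2 ^ k := by
      have : 𝒯.card ≤ 2 ^ k := by simpa using Finset.card_le_univ 𝒯
      exact_mod_cast this
    rw [bernoulliMean_sum]
    calc _ ≤ ∑ x : Fin k → Bool, (2 : ℝ) ^ k * (1 / 8) ^ k := by
          refine Finset.sum_le_sum fun x _ => ?_
          rw [bernoulliMean_sum]
          refine (Finset.sum_le_sum (hterm x)).trans ?_
          rw [Finset.sum_const, nsmul_eq_mul]
          gcongr
      _ = 1 / 2 ^ k := by
          rw [Finset.sum_const, nsmul_eq_mul, Finset.card_univ]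
          simp only [Fintype.card_fun, Fintype.card_bool, Fintype.card_fin, Nat.cast_pow,
            Nat.cast_ofNat]
          rw [← mul_pow, ← mul_pow, ← one_div_pow]
          norm_num

end RandomPolytope

/-! ### Transfer to the polytope graph, choice of `k`, and the limit. -/

namespace RandomPolytope

variable {n k : ℕ}

open Classical in
/-- The points of the cube that correspond to a set of vertices of a `0/1`-polytope. -/
noncomputable def bitsOf {P : Set (Fin n → ℝ)} (A : Set (vertices P)) : Finset (Fin n → Bool) :=
  Finset.univ.filter fun u => ∃ h : cubePoint u ∈ vertices P, (⟨cubePoint u, h⟩ : vertices P) ∈ A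

theorem mem_bitsOf {P : Set (Fin n → ℝ)} {A : Set (vertices P)} {u : Fin n → Bool} :
    u ∈ bitsOf A ↔ ∃ h : cubePoint u ∈ vertices P, (⟨cubePoint u, h⟩ : vertices P) ∈ A := by
  classical
  simp [bitsOf]

theorem cubePoint_mem_vertices {U : Finset (Fin n → Bool)} {u : Fin n → Bool} :
    cubePoint u ∈ vertices (zeroOnePolytope (U : Set (Fin n → Bool))) ↔ u ∈ U := by
  rw [vertices_zeroOnePolytope, cubePoint_injective.mem_set_image, Finset.mem_coe]

theorem bitsOf_subset {U : Finset (Fin n → Bool)}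
    (A : Set (vertices (zeroOnePolytope (U : Set (Fin n → Bool))))) : bitsOf A ⊆ U := by
  intro u hu
  obtain ⟨h, -⟩ := mem_bitsOf.1 hu
  exact cubePoint_mem_vertices.1 h

theorem card_bitsOf {U : Finset (Fin n → Bool)}
    (A : Set (vertices (zeroOnePolytope (U : Set (Fin n → Bool))))) :
    (bitsOf A).card = A.ncard := by
  rw [← Set.ncard_coe_finset, ← Set.ncard_image_of_injective _ cubePoint_injective,
    ← Set.ncard_image_of_injective A Subtype.val_injective]
  congr 1
  ext x
  constructor
  · rintro ⟨u, hu, rfl⟩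
    obtain ⟨h, hA⟩ := mem_bitsOf.1 (Finset.mem_coe.1 hu)
    exact ⟨_, hA, rfl⟩
  · rintro ⟨⟨y, hy⟩, hA, rfl⟩
    have hy' := hy
    rw [vertices_zeroOnePolytope] at hy'
    obtain ⟨u, -, rfl⟩ := hy'
    exact ⟨u, Finset.mem_coe.2 (mem_bitsOf.2 ⟨hy, hA⟩), rfl⟩

theorem natCard_vertices (U : Finset (Fin n → Bool)) :
    Nat.card (vertices (zeroOnePolytope (U : Set (Fin n → Bool)))) = U.card := by
  rw [Nat.card_coe_set_eq, vertices_zeroOnePolytope,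
    Set.ncard_image_of_injective _ cubePoint_injective, Set.ncard_coe_finset]

instance finite_vertices (U : Finset (Fin n → Bool)) :
    Finite (vertices (zeroOnePolytope (U : Set (Fin n → Bool)))) := by
  rw [Set.finite_coe_iff, vertices_zeroOnePolytope]
  exact U.finite_toSet.image _

theorem card_cutPairs_le_numEdges {U : Finset (Fin n → Bool)}
    (A : Set (vertices (zeroOnePolytope (U : Set (Fin n → Bool))))) :
    (cutPairs U (bitsOf A)).card ≤
      numEdges (polytopeGraph (zeroOnePolytope (U : Set (Fin n → Bool)))) A Aᶜ := by
  classical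
  set t : Set (Sym2 (vertices (zeroOnePolytope (U : Set (Fin n → Bool))))) :=
    {e ∈ (polytopeGraph (zeroOnePolytope (U : Set (Fin n → Bool)))).edgeSet |
      ∃ x ∈ A, ∃ y ∈ Aᶜ, e = s(x, y)} with ht
  change _ ≤ t.ncard
  have hfin : t.Finite := Set.toFinite t
  rw [Set.ncard_eq_toFinset_card t hfin]
  refine Finset.card_le_card_of_forall_subsingleton
    (fun (q : (Fin n → Bool) × (Fin n → Bool))
      (e : Sym2 (vertices (zeroOnePolytope (U : Set (Fin n → Bool))))) =>
      ∃ (hu : cubePoint q.1 ∈ vertices (zeroOnePolytope (U : Set (Fin n → Bool))))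
        (hv : cubePoint q.2 ∈ vertices (zeroOnePolytope (U : Set (Fin n → Bool)))),
        e = s(⟨cubePoint q.1, hu⟩, ⟨cubePoint q.2, hv⟩)) ?_ ?_
  · rintro ⟨u, v⟩ hq
    obtain ⟨⟨huA, hvU, hvA⟩, hadj⟩ := mem_cutPairs.1 hq
    obtain ⟨hu, huA'⟩ := mem_bitsOf.1 huA
    have hv : cubePoint v ∈ vertices (zeroOnePolytope (U : Set (Fin n → Bool))) :=
      cubePoint_mem_vertices.2 hvU
    have huU := bitsOf_subset A huA
    refine ⟨s(⟨cubePoint u, hu⟩, ⟨cubePoint v, hv⟩), ?_, hu, hv, rfl⟩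
    rw [Set.Finite.mem_toFinset]
    refine ⟨?_, _, huA', _, fun h => hvA (mem_bitsOf.2 ⟨hv, h⟩), rfl⟩
    rw [SimpleGraph.mem_edgeSet]
    refine ⟨fun h => hvA ?_, ?_⟩
    · rwa [← cubePoint_injective (Subtype.ext_iff.1 h)]
    · rcases hadj with h | h
      · exact isFaceOfDim_segment_of_cubeAdj huU hvU h
      · rw [segment_symm]
        exact isFaceOfDim_segment_of_cubeAdj hvU huU h
  · rintro e - ⟨u, v⟩ ⟨hq, hu, hv, he⟩ ⟨u', v'⟩ ⟨hq', hu', hv', he'⟩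
    rw [he, Sym2.eq_iff] at he'
    have h1 := (mem_cutPairs.1 hq).1
    have h2 := (mem_cutPairs.1 hq').1
    simp only [Subtype.mk.injEq] at he'
    rcases he' with ⟨h3, h4⟩ | ⟨h3, -⟩
    · exact Prod.ext (cubePoint_injective h3) (cubePoint_injective h4)
    · exact absurd h1.1 (by rw [cubePoint_injective h3]; exact h2.2.2)

/-- Typical fibres force edge expansion, with a stronger bound for small sets. -/
theorem TypicalFibres.expansion {hk : k ≤ n} {U : Finset (Fin n → Bool)} {K : ℝ}
    (h : TypicalFibres hk U K) (hK : 1 ≤ K) (hk2 : 2 ≤ k) :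
    1 / (128 * K ^ 3) ≤
        edgeExpansion (polytopeGraph (zeroOnePolytope (U : Set (Fin n → Bool)))) ∧
      ∀ A : Set (vertices (zeroOnePolytope (U : Set (Fin n → Bool)))),
        (A.ncard : ℝ) ≤ 1 / (4 * K ^ 2) *
          (Nat.card (vertices (zeroOnePolytope (U : Set (Fin n → Bool)))) : ℝ) →
        A.ncard ≤ numEdges (polytopeGraph (zeroOnePolytope (U : Set (Fin n → Bool)))) A Aᶜ := by
  have hK0 : 0 < K := by linarith
  have hcard := natCard_vertices U
  constructor
  -- A real infimum over the empty set would be 0, so an admissible set must exist; two vertices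
  -- make a singleton admissible.
  · have hU : 2 ≤ U.card := by
      have h1 := h.two_pow_le_two_mul_card (by omega)
      have h2 : 2 ^ 2 ≤ 2 ^ k := Nat.pow_le_pow_right (by norm_num) hk2
      omega
    refine le_csInf ?_ ?_
    · obtain ⟨u, hu⟩ := Finset.card_pos.1 (by omega : 0 < U.card)
      refine ⟨_, {⟨cubePoint u, cubePoint_mem_vertices.2 hu⟩}, ?_, ?_, rfl⟩
      · rw [Set.ncard_singleton]
      · rw [Set.ncard_singleton, hcard, Nat.cast_one, le_div_iff₀ two_pos, one_mul]
        exact_mod_cast hU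
    · rintro r ⟨S, hS1, hS2, rfl⟩
      rw [hcard, le_div_iff₀ two_pos] at hS2
      have hS : (0 : ℝ) < S.ncard := by exact_mod_cast hS1
      have h1 := h.card_le_mul_card_cutPairs hK (by omega) (bitsOf_subset S) (by
        rw [card_bitsOf, mul_comm]; exact_mod_cast hS2)
      have h2 : ((cutPairs U (bitsOf S)).card : ℝ) ≤
          numEdges (polytopeGraph (zeroOnePolytope (U : Set (Fin n → Bool)))) S Sᶜ := by
        exact_mod_cast card_cutPairs_le_numEdges S
      rw [card_bitsOf] at h1
      rw [div_le_div_iff₀ (by positivity) hS, one_mul, mul_comm _ (128 * K ^ 3)]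
      exact h1.trans (by gcongr)
  · intro A hA
    rw [hcard, one_div_mul_eq_div, le_div_iff₀ (by positivity)] at hA
    have h1 := h.card_le_card_cutPairs hK (bitsOf_subset A) (by rw [card_bitsOf]; linarith)
    rw [card_bitsOf] at h1
    exact h1.trans (card_cutPairs_le_numEdges A)

/-- The bound for the exponential moment of the fibre sizes. -/
noncomputable def momentBound : ℝ := 2 * Real.exp (120 * (256 - 1))

theorem one_le_momentBound : 1 ≤ momentBound := by
  have := Real.one_le_exp (show (0 : ℝ) ≤ 120 * (256 - 1) by norm_num)
  unfold momentBound
  linarith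

theorem real_not_typicalFibres_le (hk : k ≤ n) (p : unitInterval)
    (h1 : 60 ≤ (p : ℝ) * 2 ^ (n - k)) (h2 : (p : ℝ) * 2 ^ (n - k) ≤ 120) :
    (randomCubeSubset n p).real {U | ∃ s : Finset (Fin n → Bool), (s : Set (Fin n → Bool)) = U ∧
        ¬ TypicalFibres hk s momentBound} ≤ (1 + Real.exp (120 * (256 ^ 2 - 1))) / 2 ^ k := by
  classical
  have hsub : {U | ∃ s : Finset (Fin n → Bool), (s : Set (Fin n → Bool)) = U ∧
      ¬ TypicalFibres hk s momentBound} ⊆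
      {U | ∃ s : Finset (Fin n → Bool), (s : Set (Fin n → Bool)) = U ∧
        ∃ x, k < 20 * degInto (Finset.univ \ occupied hk s) x} ∪
      {U | ∃ s : Finset (Fin n → Bool), (s : Set (Fin n → Bool)) = U ∧
        2 * Real.exp (120 * (256 - 1)) * 2 ^ k < ∑ x, (256 : ℝ) ^ (fibre hk s x).card} := by
    rintro U ⟨s, hs, hnot⟩
    by_contra hcon
    refine hnot ⟨fun x => ?_, ?_⟩
    · by_contra hx
      exact hcon (Or.inl ⟨s, hs, x, by convert not_le.1 hx⟩)
    · by_contra hx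
      exact hcon (Or.inr ⟨s, hs, not_le.1 hx⟩)
  have : MeasureTheory.IsProbabilityMeasure (randomCubeSubset n p) := by
    unfold randomCubeSubset; infer_instance
  calc _ ≤ _ := MeasureTheory.measureReal_mono hsub (MeasureTheory.measure_ne_top _ _)
    _ ≤ _ := MeasureTheory.measureReal_union_le _ _
    _ ≤ 1 / 2 ^ k + Real.exp (120 * (256 ^ 2 - 1)) / 2 ^ k :=
      add_le_add (real_exists_lt_degInto_le hk p h1)
        (real_sum_pow_card_fibre_gt_le hk p (by norm_num) h2)
    _ = _ := by ring

/-- Take `m` with `2 ^ m ≤ 60 / p < 2 ^ (m + 1)` and `k = n - (m + 1)`. As `60 ≤ 2 ^ 6`, the lower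
bound on `p` gives `m ≤ 6 + 99 * n / 100`. -/
theorem exists_dimension {p : ℝ} (hn : 1000 ≤ n) (hp : (2 : ℝ) ^ (-(99 / 100 : ℝ) * (n : ℝ)) ≤ p)
    (hp1 : p ≤ 1) :
    ∃ k ≤ n, 2 ≤ k ∧ (n : ℝ) / 100 - 7 ≤ k ∧ 60 ≤ p * 2 ^ (n - k) ∧ p * 2 ^ (n - k) ≤ 120 := by
  have hp0 : 0 < p := lt_of_lt_of_le (by positivity) hp
  obtain ⟨m, hm1, hm2⟩ := exists_nat_pow_near (x := 60 / p) (y := 2)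
    (by rw [le_div_iff₀ hp0]; linarith) one_lt_two
  rw [le_div_iff₀ hp0] at hm1
  rw [div_lt_iff₀ hp0] at hm2
  have hm : (m : ℝ) ≤ 6 + 99 / 100 * n := by
    have h1 : (2 : ℝ) ^ (m : ℝ) * 2 ^ (-(99 / 100 : ℝ) * (n : ℝ)) ≤ 2 ^ (6 : ℝ) := by
      calc _ ≤ (2 : ℝ) ^ (m : ℝ) * p := by gcongr
        _ ≤ 60 := by rw [Real.rpow_natCast]; exact hm1
        _ ≤ _ := by norm_num
    rw [← Real.rpow_add two_pos, Real.rpow_le_rpow_left_iff one_lt_two] at h1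
    linarith
  have hn' : (1000 : ℝ) ≤ n := by exact_mod_cast hn
  have hmn : m + 3 ≤ n := by
    have : (m : ℝ) + 3 ≤ n := by linarith
    exact_mod_cast this
  refine ⟨n - (m + 1), Nat.sub_le _ _, by omega, ?_, ?_, ?_⟩
  · rw [Nat.cast_sub (by omega)]
    push_cast
    linarith
  · rw [Nat.sub_sub_self (by omega)]
    linarith
  · rw [Nat.sub_sub_self (by omega), pow_succ]
    linarith

theorem one_sub_le_real_of_expansion (hn : 1000 ≤ n) {p : unitInterval}
    (hp : (2 : ℝ) ^ (-(99 / 100 : ℝ) * (n : ℝ)) ≤ p) :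
    1 - (1 + Real.exp (120 * (256 ^ 2 - 1))) * (2 : ℝ) ^ (7 - (n : ℝ) / 100) ≤
      (randomCubeSubset n p).real {U : Set (Fin n → Bool) |
        1 / (128 * momentBound ^ 3) ≤ edgeExpansion (polytopeGraph (zeroOnePolytope U)) ∧
        ∀ A : Set (vertices (zeroOnePolytope U)),
          (A.ncard : ℝ) ≤ 1 / (4 * momentBound ^ 2) *
            (Nat.card (vertices (zeroOnePolytope U)) : ℝ) →
          A.ncard ≤ numEdges (polytopeGraph (zeroOnePolytope U)) A Aᶜ} := by
  classical
  obtain ⟨k, hk, hk2, hkn, h1, h2⟩ := exists_dimension hn hp p.2.2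
  have : MeasureTheory.IsProbabilityMeasure (randomCubeSubset n p) := by
    unfold randomCubeSubset; infer_instance
  set E := {U : Set (Fin n → Bool) |
        1 / (128 * momentBound ^ 3) ≤ edgeExpansion (polytopeGraph (zeroOnePolytope U)) ∧
        ∀ A : Set (vertices (zeroOnePolytope U)),
          (A.ncard : ℝ) ≤ 1 / (4 * momentBound ^ 2) *
            (Nat.card (vertices (zeroOnePolytope U)) : ℝ) →
          A.ncard ≤ numEdges (polytopeGraph (zeroOnePolytope U)) A Aᶜ} with hE
  have hcover : Set.univ ⊆ E ∪ {U | ∃ s : Finset (Fin n → Bool), (s : Set (Fin n → Bool)) = U ∧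
        ¬ TypicalFibres hk s momentBound} := by
    intro U _
    have hU : ((U.toFinset : Finset (Fin n → Bool)) : Set (Fin n → Bool)) = U := by simp
    by_cases h : TypicalFibres hk U.toFinset momentBound
    · left
      have := h.expansion one_le_momentBound hk2
      rwa [hU] at this
    · exact Or.inr ⟨_, hU, h⟩
  have h3 : (1 : ℝ) ≤ (randomCubeSubset n p).real E +
      (1 + Real.exp (120 * (256 ^ 2 - 1))) / 2 ^ k := by
    calc (1 : ℝ) = (randomCubeSubset n p).real Set.univ := by simp
      _ ≤ _ := MeasureTheory.measureReal_mono hcover (MeasureTheory.measure_ne_top _ _)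
      _ ≤ _ := MeasureTheory.measureReal_union_le _ _
      _ ≤ _ := add_le_add le_rfl (real_not_typicalFibres_le hk p h1 h2)
  have h4 : (1 + Real.exp (120 * (256 ^ 2 - 1))) / 2 ^ k ≤
      (1 + Real.exp (120 * (256 ^ 2 - 1))) * (2 : ℝ) ^ (7 - (n : ℝ) / 100) := by
    rw [div_eq_mul_inv]
    gcongr
    rw [← Real.rpow_natCast, ← Real.rpow_neg two_pos.le]
    apply Real.rpow_le_rpow_of_exponent_le one_le_two
    linarith
  linarith

theorem tendsto_one_sub_mul_rpow (c : ℝ) :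
    Tendsto (fun n : ℕ => 1 - c * (2 : ℝ) ^ (7 - (n : ℝ) / 100)) atTop (𝓝 1) := by
  have h1 : Tendsto (fun n : ℕ => (7 : ℝ) - (n : ℝ) / 100) atTop atBot := by
    have := tendsto_natCast_atTop_atTop (R := ℝ) |>.atTop_div_const (by norm_num : (0 : ℝ) < 100)
    simpa only [sub_eq_add_neg, Function.comp_def] using
      tendsto_atBot_add_const_left _ 7 (tendsto_neg_atTop_atBot.comp this)
  have h2 := (tendsto_rpow_atBot_of_base_gt_one 2 one_lt_two).comp h1
  simpa using (h2.const_mul c).const_sub 1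

end RandomPolytope

theorem theorem1p2 :
    ∃ β η : ℝ, 0 < β ∧ 0 < η ∧
      ∀ p : ℕ → unitInterval,
        (∀ᶠ n : ℕ in atTop, (2 : ℝ) ^ (-(99 / 100 : ℝ) * (n : ℝ)) ≤ (p n : ℝ)) →
        Tendsto
          (fun n : ℕ => RandomPolytope.randomCubeSubset n (p n)
            {U : Set (Fin n → Bool) |
              β ≤ RandomPolytope.edgeExpansion
                (RandomPolytope.polytopeGraph (RandomPolytope.zeroOnePolytope U)) ∧
              ∀ A : Set (RandomPolytope.vertices (RandomPolytope.zeroOnePolytope U)),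
                (A.ncard : ℝ) ≤
                  η * (Nat.card (RandomPolytope.vertices (RandomPolytope.zeroOnePolytope U)) : ℝ) →
                A.ncard ≤ RandomPolytope.numEdges
                  (RandomPolytope.polytopeGraph (RandomPolytope.zeroOnePolytope U)) A Aᶜ})
          atTop (𝓝 1) := by
  have hK : 0 < RandomPolytope.momentBound := by linarith [RandomPolytope.one_le_momentBound]
  refine ⟨1 / (128 * RandomPolytope.momentBound ^ 3), 1 / (4 * RandomPolytope.momentBound ^ 2),
    by positivity, by positivity, fun p hp => ?_⟩
  have hprob : ∀ n, MeasureTheory.IsProbabilityMeasure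
      (RandomPolytope.randomCubeSubset n (p n)) := by
    intro n
    unfold RandomPolytope.randomCubeSubset
    infer_instance
  have hlim := ENNReal.tendsto_ofReal (RandomPolytope.tendsto_one_sub_mul_rpow
    (1 + Real.exp (120 * (256 ^ 2 - 1))))
  rw [ENNReal.ofReal_one] at hlim
  refine tendsto_of_tendsto_of_tendsto_of_le_of_le' hlim tendsto_const_nhds ?_
    (Eventually.of_forall fun n => MeasureTheory.prob_le_one)
  filter_upwards [hp, eventually_ge_atTop 1000] with n hpn hn
  rw [ENNReal.ofReal_le_iff_le_toReal (MeasureTheory.measure_ne_top _ _)]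
  exact RandomPolytope.one_sub_le_real_of_expansion hn hpn
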